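/- For $m\ge 0$ let $S_m$ be the group of permutations of $\{1,\dots,m\}$, and regard $S_{n-1}$ as the subgroup of $S_n$ of permutations fixing $n$. Let $H_r(-)$ denote group homology with trivial coefficients $\mathbb{Z}$. (a) For all integers $r\ge 0$ and $n>2r$, the homomorphism $H_r(S_{n-1})\to H_r(S_n)$ induced by the inclusion $S_{n-1}\subset S_n$ is an isomorphism. (b) For $n\ge 1$ let $X(n)$ be the $\Delta$-complex that has one ordered $k$-simplex for each sequence of $k+1$ distinct elements of $\{1,\dots,n\}$, whose faces are given by the subsequences obtained by deleting one entry. Then $X(n)$ is $(n-1)$-spherical, that is, it is nonempty and its reduced integral homology satisfies $\tilde H_i(X(n))=0$ for all $i\ne n-1$. -/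

import Mathlib

noncomputable section

/-! ### Homology of the symmetric groups -/

namespace SymmetricGroup

/-- The standard inclusion of the symmetric group on `m` letters into the symmetric group on
`m + 1` letters: a permutation is extended by fixing the last letter. -/
def stabilization (m : ℕ) : Equiv.Perm (Fin m) →* Equiv.Perm (Fin (m + 1)) :=
  Equiv.Perm.extendDomainHom (finSuccAboveEquiv (Fin.last m))

theorem stabilization_castSucc (m : ℕ) (σ : Equiv.Perm (Fin m)) (i : Fin m) :
    stabilization m σ i.castSucc = (σ i).castSucc := by
  have h := Equiv.Perm.extendDomain_apply_image σ (finSuccAboveEquiv (Fin.last m)) i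
  simpa [finSuccAboveEquiv_apply, stabilization] using h

theorem stabilization_last (m : ℕ) (σ : Equiv.Perm (Fin m)) :
    stabilization m σ (Fin.last m) = Fin.last m :=
  Equiv.Perm.extendDomain_apply_not_subtype σ _ (by simp)

/-- The integral group homology `H_r(S_m; ℤ)`, with trivial coefficients. -/
abbrev homology (m r : ℕ) : ModuleCat ℤ :=
  groupHomology (Rep.trivial ℤ (Equiv.Perm (Fin m)) ℤ) r

/-- The map `H_r(S_m; ℤ) ⟶ H_r(S_{m+1}; ℤ)` induced by the standard inclusion (and by the
identity of the coefficients). -/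
def homologyStabilization (m r : ℕ) : homology m r ⟶ homology (m + 1) r :=
  groupHomology.map (stabilization m)
    (Rep.ofHom ⟨LinearMap.id, fun _ => rfl⟩ :
      Rep.trivial ℤ (Equiv.Perm (Fin m)) ℤ ⟶
        Rep.res (stabilization m) (Rep.trivial ℤ (Equiv.Perm (Fin (m + 1))) ℤ)) r

end SymmetricGroup

/-! ### Δ-complexes and their reduced homology -/

/-- The combinatorial data of a Δ-complex: the sets of ordered `k`-simplices and the face maps
(`face i` deletes the `i`-th vertex), subject to the usual identities. -/
structure DeltaComplex where
  Simplex : ℕ → Type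
  face : ∀ {k : ℕ}, Fin (k + 2) → Simplex (k + 1) → Simplex k
  face_face : ∀ {k : ℕ} {i j : Fin (k + 2)}, i ≤ j → ∀ x : Simplex (k + 2),
    face i (face j.succ x) = face j (face i.castSucc x)

namespace DeltaComplex

open CategoryTheory

variable (X : DeltaComplex)

/-- The simplicial boundary `∂ x = ∑ᵢ (-1)ⁱ dᵢ x` on the free abelian groups on the simplices. -/
def boundary (k : ℕ) : (X.Simplex (k + 1) →₀ ℤ) →ₗ[ℤ] (X.Simplex k →₀ ℤ) :=
  ∑ i : Fin (k + 2), (-1 : ℤ) ^ (i : ℕ) • Finsupp.lmapDomain ℤ ℤ (X.face i)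

theorem boundary_single (k : ℕ) (x : X.Simplex (k + 1)) (a : ℤ) :
    X.boundary k (Finsupp.single x a) =
      ∑ i : Fin (k + 2), (-1 : ℤ) ^ (i : ℕ) • Finsupp.single (X.face i x) a := by
  simp [boundary, LinearMap.sum_apply, Finsupp.mapDomain_single]

theorem boundary_comp_boundary (k : ℕ) : X.boundary k ∘ₗ X.boundary (k + 1) = 0 := by
  refine Finsupp.lhom_ext fun x a => ?_
  rw [LinearMap.comp_apply, boundary_single, map_sum]
  simp only [map_zsmul, boundary_single, Finset.smul_sum, smul_smul, LinearMap.zero_apply]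
  rw [Finset.sum_comm, ← Finset.sum_product', Finset.univ_product_univ]
  let S : Finset (Fin (k + 2) × Fin (k + 3)) := {ij | (ij.2 : ℕ) ≤ (ij.1 : ℕ)}
  rw [← Finset.sum_add_sum_compl S, ← eq_neg_iff_add_eq_zero, ← Finset.sum_neg_distrib]
  refine Finset.sum_bij (fun ij hij => (Fin.castLT ij.2
    (lt_of_le_of_lt (Finset.mem_filter.mp hij).right (Fin.is_lt ij.1)), ij.1.succ)) ?_ ?_ ?_ ?_
  · intro ij hij
    simp only [S, Finset.compl_filter, Finset.mem_filter_univ, Fin.val_succ,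
      Fin.val_castLT] at hij ⊢
    lia
  · rintro ⟨i, j⟩ hij ⟨i', j'⟩ hij' h
    simp only [Prod.mk.injEq, Fin.ext_iff, Fin.val_succ, Fin.val_castLT] at h ⊢
    lia
  · rintro ⟨i, j⟩ hij
    simp only [S, Finset.compl_filter, Finset.mem_filter_univ, not_le] at hij
    refine ⟨(j.pred (by rintro rfl; simp at hij), i.castSucc), ?_, ?_⟩
    · simp only [S, Finset.mem_filter_univ, Fin.val_castSucc, Fin.val_pred]
      lia
    · simp
  · rintro ⟨i, j⟩ hij
    simp only [S, Finset.mem_filter_univ] at hij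
    obtain ⟨j, rfl⟩ : ∃ j' : Fin (k + 2), j = j'.castSucc :=
      ⟨j.castLT (lt_of_le_of_lt hij i.is_lt), by simp⟩
    rw [← neg_smul]
    simp only [Fin.castLT_castSucc, Fin.val_succ, Fin.val_castSucc]
    rw [X.face_face (show j ≤ i from hij)]
    congr 1
    ring

/-- The simplicial chain complex of a Δ-complex, with integral coefficients. -/
def chainComplex : ChainComplex (ModuleCat ℤ) ℕ :=
  ChainComplex.of (fun k => ModuleCat.of ℤ (X.Simplex k →₀ ℤ))
    (fun k => ModuleCat.ofHom (X.boundary k))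
    (fun k => by rw [← ModuleCat.ofHom_comp, boundary_comp_boundary]; rfl)

/-- The augmentation, which sends every vertex to `1`. -/
def augmentation : (X.Simplex 0 →₀ ℤ) →ₗ[ℤ] ℤ :=
  Finsupp.linearCombination ℤ fun _ => (1 : ℤ)

theorem augmentation_comp_boundary : X.augmentation ∘ₗ X.boundary 0 = 0 := by
  refine Finsupp.lhom_ext fun x a => ?_
  rw [LinearMap.comp_apply, boundary_single, Fin.sum_univ_two]
  simp [augmentation]

theorem chainComplex_d_comp_augmentation :
    X.chainComplex.d 1 0 ≫ ModuleCat.ofHom X.augmentation = 0 := by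
  have h : ModuleCat.ofHom (X.boundary 0) ≫ ModuleCat.ofHom X.augmentation = 0 := by
    rw [← ModuleCat.ofHom_comp, augmentation_comp_boundary]
    rfl
  have h' : X.chainComplex.d 1 0 = ModuleCat.ofHom (X.boundary 0) :=
    ChainComplex.of_d (fun k => ModuleCat.of ℤ (X.Simplex k →₀ ℤ))
      (fun k => ModuleCat.ofHom (X.boundary k)) 0
  exact (congrArg (fun f => f ≫ ModuleCat.ofHom X.augmentation) h').trans h

/-- The augmented chain complex, indexed so that the `k`-simplices sit in degree `k + 1`. -/
def augmentedChainComplex : ChainComplex (ModuleCat ℤ) ℕ :=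
  X.chainComplex.augment (ModuleCat.ofHom X.augmentation) X.chainComplex_d_comp_augmentation

/-- The reduced integral homology group in degree `i ≥ 0`. -/
def reducedHomology (i : ℕ) : ModuleCat ℤ :=
  X.augmentedChainComplex.homology (i + 1)

/-- `X` is `d`-spherical: it is nonempty, and its reduced homology vanishes in all degrees other
than `d` (in degree `-1` it vanishes because `X` is nonempty). -/
def IsSpherical (d : ℕ) : Prop :=
  Nonempty (X.Simplex 0) ∧ ∀ i : ℕ, i ≠ d → Limits.IsZero (X.reducedHomology i)

end DeltaComplex

/-- The complex of ordered subsets of an `n`-element set: its `k`-simplices are the sequences of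
`k + 1` distinct elements, and the faces are obtained by deleting one entry. -/
def orderedSubsetComplex (n : ℕ) : DeltaComplex where
  Simplex k := Fin (k + 1) ↪ Fin n
  face i x := (Fin.succAboveEmb i).trans x
  face_face {k i j} hij x := by
    ext l
    have h := congrArg (fun f => f.toOrderHom l) (SimplexCategory.δ_comp_δ hij)
    exact congrArg (fun t => ((x t : Fin n) : ℕ)) h

end

open CategoryTheory

universe u

noncomputable section

section ModuleComplexes

variable {k : Type u} [CommRing k]

/-! Both parts rest on the augmented complex `W` of injective words on `n` letters, with `W_p` free
on the words of length `p` and the empty word in degree `0`.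

It is exact at `W_p` for `p < n` (`Word.exists_boundary_eq`), by induction on the alphabet. Fix a
letter `a`. A cycle avoiding `a` is the boundary of its cone, obtained by writing `a` in front. In
general, let `j` be the last position where `a` occurs; for each prefix `u` of length `j`, the tails
following `u a` form a cycle on a smaller alphabet. Filling that cycle and subtracting a boundary
removes these words, so `a` moves to earlier positions until it disappears. Part (b) follows, since
there are no words longer than `n`.

For part (a), `S_n` acts transitively on the words of length `p ≤ n` with stabilizer `S_{n-p}`, so
Shapiro's lemma gives `H_q(S_n; W_p) = H_q(S_{n-p})`. The faces of a word differ by permutations of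
its letters, which commute with its stabilizer; inner automorphisms act trivially on homology, so
all faces induce the stabilization map. The boundary `W_{p+1} → W_p` is an alternating sum of `p +
1` faces: it induces stabilization for `p` even and `0` for `p` odd.

Exactness cuts `W` into short exact sequences `0 → Z_{p+1} → W_{p+2} → Z_p → 0` with `Z_p = ker
(W_{p+1} → W_p)`. Their long exact sequences replace the usual spectral sequence: stability in lower
degrees makes `H_q(W_{p+2}) → H_q(Z_p)` surjective in a range (`epi_coeffMap_toCyclesHom`), and `0 →
Z_0 → W_1 → W_0 → 0` then gives stability in the next degree (`stableInDegree`). -/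

theorem ChainComplex.isZero_homology_succ_of_exact (C : ChainComplex (ModuleCat.{u} k) ℕ) (i : ℕ)
    (h : ∀ x : C.X (i + 1), C.d (i + 1) i x = 0 → ∃ y : C.X (i + 2), C.d (i + 2) (i + 1) y = x) :
    Limits.IsZero (C.homology (i + 1)) := by
  rw [← HomologicalComplex.exactAt_iff_isZero_homology,
    HomologicalComplex.exactAt_iff' C (i + 2) (i + 1) i (by simp) (by simp),
    ShortComplex.moduleCat_exact_iff]
  exact h

end ModuleComplexes

/-! ### Vanishing of group homology by a contracting homotopy -/

namespace groupHomology

open Rep Finsupp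

variable {k G : Type u} [CommRing k] [Group G]

theorem _root_.Fin.contractNth_zero_cons {α : Type*} {n : ℕ} (op : α → α → α) (a : α)
    (σ : Fin (n + 1) → α) :
    Fin.contractNth 0 op (Fin.cons a σ : Fin (n + 2) → α) = Fin.cons (op a (σ 0)) (Fin.tail σ) := by
  funext i
  refine Fin.cases ?_ (fun i => ?_) i
  · simp [Fin.contractNth]
  · simp [Fin.contractNth, Fin.tail]

theorem _root_.Fin.contractNth_succ_cons {α : Type*} {n : ℕ} (op : α → α → α) (a : α)
    (σ : Fin (n + 1) → α) (j : Fin (n + 1)) :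
    Fin.contractNth j.succ op (Fin.cons a σ : Fin (n + 2) → α) =
      Fin.cons a (Fin.contractNth j op σ) := by
  funext i
  refine Fin.cases ?_ (fun i => ?_) i
  · simp [Fin.contractNth]
  · simp [Fin.contractNth, Fin.castSucc_succ]

/-- If the identity of `A` is the trace of a linear endomorphism, then `A` has no homology in
positive degrees. -/
theorem isZero_succ_of_trace_eq_id [Fintype G] (A : Rep k G) (θ : A →ₗ[k] A)
    (hθ : ∀ a : A, ∑ g : G, A.ρ g⁻¹ (θ (A.ρ g a)) = a) (n : ℕ) :
    Limits.IsZero (groupHomology A (n + 1)) := by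
  apply ChainComplex.isZero_homology_succ_of_exact
  -- The contracting homotopy: prepend every `γ` and apply `θ ∘ γ` to the coefficient. In `D h + h
  -- D` the leading face yields the trace of `θ`, which is the identity, and all other terms cancel.
  let h (m : ℕ) : ((Fin m → G) →₀ A) →ₗ[k] ((Fin (m + 1) → G) →₀ A) :=
    lsum k fun σ => ∑ γ : G, lsingle (Fin.cons γ σ : Fin (m + 1) → G) ∘ₗ θ ∘ₗ A.ρ γ
  have hs (m : ℕ) (σ : Fin m → G) (a : A) :
      h m (single σ a) = ∑ γ : G, single (Fin.cons γ σ : Fin (m + 1) → G) (θ (A.ρ γ a)) := by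
    simp [h]
  let D (m : ℕ) : ((Fin (m + 1) → G) →₀ A) →ₗ[k] ((Fin m → G) →₀ A) :=
    (inhomogeneousChains.d A m).hom
  have hD (m : ℕ) (σ : Fin (m + 1) → G) (a : A) : D m (single σ a) =
      single (fun i => σ i.succ) (A.ρ (σ 0)⁻¹ a) +
        ∑ j : Fin (m + 1), (-1 : k) ^ ((j : ℕ) + 1) • single (Fin.contractNth j (· * ·) σ) a :=
    inhomogeneousChains.d_single m σ a
  have key (x : (Fin (n + 1) → G) →₀ A) : D (n + 1) (h (n + 1) x) + h n (D n x) = x := by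
    induction x using Finsupp.induction_linear with
    | zero => simp
    | add x y hx hy =>
      rw [map_add, map_add, map_add, map_add, add_add_add_comm, hx, hy]
    | single σ a =>
      rw [hs, map_sum]
      simp only [hD, map_add, map_sum, map_smul, hs]
      have h1 : ∑ γ : G, single σ (A.ρ γ⁻¹ (θ (A.ρ γ a))) = single σ a := by
        rw [← Finsupp.single_finsetSum, hθ]
      have h2 : ∑ γ : G, single (Fin.cons (γ * σ 0) (Fin.tail σ) : Fin (n + 1) → G) (θ (A.ρ γ a)) =
          ∑ γ : G, single (Fin.cons γ (Fin.tail σ) : Fin (n + 1) → G)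
            (θ (A.ρ γ (A.ρ (σ 0)⁻¹ a))) := by
        refine Fintype.sum_equiv (Equiv.mulRight (σ 0)) _ _ fun γ => ?_
        simp [← Module.End.mul_apply, ← map_mul]
      simp only [Fin.sum_univ_succ (n := n + 1), Fin.contractNth_zero_cons,
        Fin.contractNth_succ_cons, Fin.cons_zero, Fin.cons_succ, Finset.sum_add_distrib]
      rw [h1, ← Finset.smul_sum, h2]
      rw [Finset.sum_comm (s := (Finset.univ : Finset G))]
      simp only [← Finset.smul_sum, Fin.val_zero, Fin.val_succ, pow_succ]
      simp only [Fin.tail_def, mul_neg, mul_one, neg_neg, pow_zero, neg_smul, one_smul,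
        Finset.sum_neg_distrib]
      abel
  intro x hx
  refine ⟨h (n + 1) x, ?_⟩
  rw [inhomogeneousChains.d_def] at hx ⊢
  have hx' : D n x = 0 := hx
  simpa [hx'] using! key x

end groupHomology

/-! ### Representations of finitely supported functions on a `G`-set -/

namespace Rep

open Finsupp

variable {k G H : Type u} [CommRing k] [Group G] [Group H]

theorem exact_of_linear {S : ShortComplex (Rep.{u} k G)}
    (h : ∀ x, S.g.hom x = 0 → ∃ y, S.f.hom y = x) : S.Exact := by
  rw [← ShortComplex.exact_map_iff_of_faithful S (forget₂ (Rep.{u} k G) (ModuleCat.{u} k)),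
    ShortComplex.moduleCat_exact_iff]
  exact h

theorem shortExact_of_linear {S : ShortComplex (Rep.{u} k G)}
    (hf : Function.Injective S.f.hom) (hg : Function.Surjective S.g.hom)
    (h : ∀ x, S.g.hom x = 0 → ∃ y, S.f.hom y = x) : S.ShortExact where
  exact := exact_of_linear h
  mono_f := (mono_iff_injective _).2 hf
  epi_g := (epi_iff_surjective _).2 hg

theorem exists_of_shortExact {S : ShortComplex (Rep.{u} k G)} (hS : S.ShortExact) (x : S.X₂)
    (hx : S.g.hom x = 0) : ∃ y, S.f.hom y = x := by
  have h := hS.exact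
  rw [← ShortComplex.exact_map_iff_of_faithful S (forget₂ (Rep.{u} k G) (ModuleCat.{u} k)),
      ShortComplex.moduleCat_exact_iff] at h
  exact h x hx

theorem shortExact_kernel {A B : Rep.{u} k G} (p : A ⟶ B) [Epi p] :
    (ShortComplex.mk (Limits.kernel.ι p) p (Limits.kernel.condition p)).ShortExact where
  exact := ShortComplex.exact_kernel p
  mono_f := inferInstance
  epi_g := ‹_›

/-- The morphism of representations given by an equivariant linear map. -/
def homMk {A B : Rep.{u} k G} (f : A →ₗ[k] B) (h : ∀ g a, f (A.ρ g a) = B.ρ g (f a)) : A ⟶ B :=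
  ConcreteCategory.ofHom (C := Rep.{u} k G) ⟨f, fun g => LinearMap.ext fun a => h g a⟩

theorem hom_ext_apply {A B : Rep.{u} k G} {φ ψ : A ⟶ B} (h : ∀ a, φ.hom a = ψ.hom a) : φ = ψ :=
  Rep.hom_ext (Representation.IntertwiningMap.ext (LinearMap.ext h))

/-- The diagonal action on the finitely supported functions from a `G`-set `X` to `B`. -/
def finsuppDiag (X : Type u) [MulAction G X] (B : Rep.{u} k G) : Rep.{u} k G :=
  Rep.of (X := X →₀ B)
    { toFun g := mapRange.linearMap (B.ρ g) ∘ₗ lmapDomain B k (g • ·)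
      map_one' := by
        refine lhom_ext fun x b => ?_
        simp [mapDomain_single]
      map_mul' g h := by
        refine lhom_ext fun x b => ?_
        simp [mapDomain_single, mul_smul] }

section finsuppDiag

variable {X : Type u} [MulAction G X]

/-- The element of `finsuppDiag X B` supported at `x` with value `b`. -/
def diagSingle {B : Rep.{u} k G} (x : X) : B →ₗ[k] finsuppDiag X B := lsingle (R := k) x

theorem finsuppDiag_ρ_single (B : Rep.{u} k G) (g : G) (x : X) (b : B) :
    (finsuppDiag X B).ρ g (diagSingle x b) = diagSingle (g • x) (B.ρ g b) := by
  change (mapRange.linearMap (B.ρ g) ∘ₗ lmapDomain B k (g • ·)) (single x b) = single _ _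
  simp [mapDomain_single]

theorem finsuppDiag_induction {B : Rep.{u} k G} {p : finsuppDiag X B → Prop}
    (a : finsuppDiag X B) (h0 : p 0) (hadd : ∀ a b, p a → p b → p (a + b))
    (hs : ∀ x b, p (diagSingle x b)) : p a :=
  Finsupp.induction_linear (motive := p) a h0 hadd hs

theorem finsuppDiag_linearMap_ext {B : Rep.{u} k G} {M : Type*} [AddCommGroup M] [Module k M]
    {f g : finsuppDiag X B →ₗ[k] M} (h : ∀ x b, f (diagSingle x b) = g (diagSingle x b)) : f = g :=
  Finsupp.lhom_ext h

/-- The linear map out of `finsuppDiag X B` given by a family of linear maps. -/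
def diagLift {B : Rep.{u} k G} {M : Type*} [AddCommGroup M] [Module k M] (φ : X → B →ₗ[k] M) :
    finsuppDiag X B →ₗ[k] M := lsum k φ

@[simp]
theorem diagLift_single {B : Rep.{u} k G} {M : Type*} [AddCommGroup M] [Module k M]
    (φ : X → B →ₗ[k] M) (x : X) (b : B) : diagLift φ (diagSingle x b) = φ x b := by
  change lsum k φ (single x b) = _
  simp

theorem finsuppDiag_hom_ext {A B : Rep.{u} k G} {φ ψ : finsuppDiag X B ⟶ A}
    (h : ∀ x b, φ.hom (diagSingle x b) = ψ.hom (diagSingle x b)) : φ = ψ :=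
  Rep.hom_ext (Representation.IntertwiningMap.ext (finsuppDiag_linearMap_ext h))

theorem diagLift_equivariant {A B : Rep.{u} k G} (φ : X → B →ₗ[k] A)
    (h : ∀ g x b, φ (g • x) (B.ρ g b) = A.ρ g (φ x b)) (g : G) (a : finsuppDiag X B) :
    diagLift φ ((finsuppDiag X B).ρ g a) = A.ρ g (diagLift φ a) := by
  induction a using finsuppDiag_induction with
  | h0 => simp
  | hadd a b ha hb => simp only [map_add, ha, hb]
  | hs x b => simp only [finsuppDiag_ρ_single, diagLift_single, h]

variable (X) in
/-- Functoriality of `finsuppDiag X B` in the coefficients `B`. -/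
def finsuppDiagMap {B B' : Rep.{u} k G} (φ : B ⟶ B') : finsuppDiag X B ⟶ finsuppDiag X B' :=
  homMk (diagLift fun x => diagSingle x ∘ₗ φ.hom.toLinearMap) <|
    diagLift_equivariant _ fun g x b => by
      simp [finsuppDiag_ρ_single, Rep.hom_comm_apply φ g b]

theorem finsuppDiagMap_single {B B' : Rep.{u} k G} (φ : B ⟶ B') (x : X) (b : B) :
    (finsuppDiagMap X φ).hom (diagSingle x b) = diagSingle x (φ.hom b) :=
  diagLift_single _ _ _

theorem finsuppDiagMap_apply {B B' : Rep.{u} k G} (φ : B ⟶ B') (a : X →₀ B) :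
    (finsuppDiagMap X φ).hom a = mapRange.linearMap φ.hom.toLinearMap a := by
  have h : (finsuppDiagMap X φ).hom.toLinearMap =
      mapRange.linearMap (α := X) φ.hom.toLinearMap := by
    refine finsuppDiag_linearMap_ext fun x b => ?_
    refine (finsuppDiagMap_single φ x b).trans ?_
    exact (mapRange_single (f := φ.hom) (hf := map_zero _)).symm
  exact LinearMap.congr_fun h a

variable (X) in
/-- `finsuppDiag` as a functor of the coefficients. -/
def finsuppDiagFunctor : Rep.{u} k G ⥤ Rep.{u} k G where
  obj B := finsuppDiag X B
  map φ := finsuppDiagMap X φ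
  map_id B := finsuppDiag_hom_ext fun x b => finsuppDiagMap_single _ _ _
  map_comp φ ψ := finsuppDiag_hom_ext fun x b => by
    rw [Rep.hom_comp]
    change _ = (finsuppDiagMap X ψ).hom ((finsuppDiagMap X φ).hom _)
    simp only [finsuppDiagMap_single]
    rfl

instance : (finsuppDiagFunctor (k := k) (G := G) X).PreservesZeroMorphisms where
  map_zero _ _ := finsuppDiag_hom_ext fun x _ =>
    (finsuppDiagMap_single _ _ _).trans (map_zero (diagSingle x))

theorem shortExact_map_finsuppDiagFunctor {S : ShortComplex (Rep.{u} k G)} (hS : S.ShortExact) :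
    (S.map (finsuppDiagFunctor X)).ShortExact := by
  refine shortExact_of_linear ?_ ?_ ?_
  · intro a b hab
    have hab : mapRange.linearMap S.f.hom.toLinearMap (show X →₀ S.X₁ from a) =
        mapRange.linearMap S.f.hom.toLinearMap (show X →₀ S.X₁ from b) :=
      (finsuppDiagMap_apply S.f a).symm.trans (hab.trans (finsuppDiagMap_apply S.f b))
    exact mapRange_injective S.f.hom (map_zero _) ((mono_iff_injective _).1 hS.mono_f) hab
  · intro a
    obtain ⟨b, hb⟩ := mapRange_surjective S.g.hom (map_zero _)
      ((epi_iff_surjective _).1 hS.epi_g) a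
    exact ⟨b, (finsuppDiagMap_apply S.g b).trans hb⟩
  · intro a ha
    have ha : mapRange.linearMap S.g.hom.toLinearMap (show X →₀ S.X₂ from a) = 0 :=
      (finsuppDiagMap_apply S.g a).symm.trans ha
    have ha' : ∀ x, ∃ y, S.f.hom y = (show X →₀ S.X₂ from a) x := fun x =>
      exists_of_shortExact hS _ (DFunLike.congr_fun ha x)
    have : ∀ a : X →₀ S.X₂, (∀ x, ∃ y, S.f.hom y = a x) →
        ∃ b : X →₀ S.X₁, mapRange.linearMap S.f.hom.toLinearMap b = a := by
      intro a ha
      have : a ∈ LinearMap.range (mapRange.linearMap (α := X) S.f.hom.toLinearMap) := by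
        rw [← Finsupp.sum_single a]
        refine Submodule.sum_mem _ fun x _ => ?_
        obtain ⟨y, hy⟩ := ha x
        exact ⟨single x y, by simp [← hy]⟩
      exact this
    obtain ⟨b, hb⟩ := this a ha'
    exact ⟨b, (finsuppDiagMap_apply S.f b).trans hb⟩

variable (X) in
/-- The sum of the values, as a morphism `finsuppDiag X B ⟶ B`. -/
def diagSum (B : Rep.{u} k G) : finsuppDiag X B ⟶ B :=
  homMk (diagLift fun _ => LinearMap.id) <| diagLift_equivariant _ fun _ _ _ => rfl

theorem diagSum_single (B : Rep.{u} k G) (x : X) (b : B) : (diagSum X B).hom (diagSingle x b) = b :=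
  diagLift_single _ _ _

instance [Nonempty X] (B : Rep.{u} k G) : Epi (diagSum X B) := by
  rw [epi_iff_surjective]
  exact fun b => ⟨diagSingle (Classical.arbitrary X) b, diagSum_single _ _ _⟩

end finsuppDiag

/-- The identity of `A` is the trace of a linear endomorphism. -/
def IdIsTrace [Fintype G] (A : Rep.{u} k G) : Prop :=
  ∃ θ : A →ₗ[k] A, ∀ a : A, ∑ g : G, A.ρ g⁻¹ (θ (A.ρ g a)) = a

theorem IdIsTrace.finsuppDiag [Fintype G] {A : Rep.{u} k G} (hA : A.IdIsTrace)
    (X : Type u) [MulAction G X] : (finsuppDiag X A).IdIsTrace := by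
  obtain ⟨θ, hθ⟩ := hA
  refine ⟨diagLift fun x => diagSingle x ∘ₗ θ, fun a => ?_⟩
  induction a using finsuppDiag_induction with
  | h0 => simp
  | hadd a b ha hb =>
    simp only [map_add, Finset.sum_add_distrib]
    rw [ha, hb]
  | hs x b =>
    simp only [finsuppDiag_ρ_single, diagLift_single, LinearMap.comp_apply, inv_smul_smul,
      ← map_sum, hθ]

/-- The map `c` exhibits the `H`-action on `X` as free, with fundamental domain `c = 1`. For `θ` the
projection onto this domain, exactly one `h`, namely `(c x)⁻¹`, contributes at each point `x`. -/
theorem idIsTrace_res_finsuppDiag [Fintype H] (f : H →* G) (X : Type u) [MulAction G X]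
    (c : X → H) (hc : ∀ h x, c (f h • x) = h * c x) (B : Rep.{u} k G) :
    (res f (finsuppDiag X B)).IdIsTrace := by
  classical
  refine ⟨diagLift (B := B) fun x => if c x = 1 then diagSingle x else 0, fun a => ?_⟩
  change ∑ h : H, (Rep.finsuppDiag X B).ρ (f h⁻¹) (diagLift (B := B) _
    ((Rep.finsuppDiag X B).ρ (f h) a)) = a
  induction a using finsuppDiag_induction with
  | h0 => simp
  | hadd a b ha hb =>
    simp only [map_add, Finset.sum_add_distrib]
    rw [ha, hb]
  | hs x b =>
    simp only [finsuppDiag_ρ_single, diagLift_single, hc]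
    rw [Finset.sum_eq_single (c x)⁻¹]
    · simp [finsuppDiag_ρ_single]
    · intro h _ hh
      rw [if_neg fun h' => hh (eq_inv_of_mul_eq_one_left h')]
      simp
    · simp

/-- Choose a representative in each right coset of the image of `f`; `c` records the remaining
factor in `H`. -/
theorem exists_equivariant_retraction (f : H →* G) (hf : Function.Injective f) :
    ∃ c : G → H, ∀ h x, c (f h • x) = h * c x := by
  let t : G → G := fun g => (Quotient.mk (QuotientGroup.rightRel f.range) g).out
  have ht (g : G) : ∃ h : H, f h = g * (t g)⁻¹ := by
    have := QuotientGroup.rightRel_apply.1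
      (Quotient.exact (Quotient.out_eq (Quotient.mk (QuotientGroup.rightRel f.range) g)))
    exact this
  choose c hc using ht
  refine ⟨c, fun h x => hf ?_⟩
  have : t (f h * x) = t x := by
    refine congrArg Quotient.out (Quotient.sound ?_)
    refine QuotientGroup.rightRel_apply.2 ⟨h⁻¹, by simp⟩
  rw [map_mul, hc, hc, smul_eq_mul, this, mul_assoc]

end Rep

/-! ### Inner automorphisms and Shapiro's lemma, by dimension shifting -/

namespace groupHomology

open Rep Finsupp

variable {k G H : Type u} [CommRing k] [Group G] [Group H]

/-- The morphism on short complexes of chains induced by a group homomorphism and compatible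
morphisms of representations. -/
def chainsMapShortComplex (f : H →* G) {S : ShortComplex (Rep.{u} k H)}
    {T : ShortComplex (Rep.{u} k G)} (φ : S ⟶ T.map (resFunctor f)) :
    S.map (chainsFunctor k H) ⟶ T.map (chainsFunctor k G) where
  τ₁ := chainsMap f φ.τ₁
  τ₂ := chainsMap f φ.τ₂
  τ₃ := chainsMap f φ.τ₃
  comm₁₂ := (chainsMap_comp f (.id G) φ.τ₁ T.f).symm.trans <|
    (chainsMap_congr rfl (congrArg (fun ψ => ψ.hom.toLinearMap) φ.comm₁₂)).trans
      (chainsMap_comp (.id H) f S.f φ.τ₂)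
  comm₂₃ := (chainsMap_comp f (.id G) φ.τ₂ T.g).symm.trans <|
    (chainsMap_congr rfl (congrArg (fun ψ => ψ.hom.toLinearMap) φ.comm₂₃)).trans
      (chainsMap_comp (.id H) f S.g φ.τ₃)

theorem δ_comp_map (f : H →* G) {S : ShortComplex (Rep.{u} k H)} {T : ShortComplex (Rep.{u} k G)}
    (hS : S.ShortExact) (hT : T.ShortExact) (φ : S ⟶ T.map (resFunctor f)) (n : ℕ) :
    δ hS (n + 1) n rfl ≫ map f φ.τ₁ n = map f φ.τ₃ (n + 1) ≫ δ hT (n + 1) n rfl :=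
  HomologicalComplex.HomologySequence.δ_naturality (chainsMapShortComplex f φ)
    (map_chainsFunctor_shortExact hS) (map_chainsFunctor_shortExact hT) (n + 1) n rfl

theorem epi_map_succ_τ₃ (f : H →* G) {S : ShortComplex (Rep.{u} k H)}
    {T : ShortComplex (Rep.{u} k G)} (hS : S.ShortExact) (hT : T.ShortExact)
    (φ : S ⟶ T.map (resFunctor f)) (n : ℕ) (h₁ : Epi (map f φ.τ₂ (n + 1)))
    (h₂ : Epi (map f φ.τ₁ n)) (h₃ : Mono (map f φ.τ₂ n)) : Epi (map f φ.τ₃ (n + 1)) := by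
  refine HomologicalComplex.HomologySequence.epi_homologyMap_τ₃ (chainsMapShortComplex f φ)
    (map_chainsFunctor_shortExact hS) (map_chainsFunctor_shortExact hT) (n + 1) h₁ ?_ ?_
  · intro j hj
    obtain rfl : j = n := by simpa using hj
    exact h₂
  · intro j hj
    obtain rfl : j = n := by simpa using hj
    exact h₃

theorem isIso_map_succ_τ₃ (f : H →* G) {S : ShortComplex (Rep.{u} k H)}
    {T : ShortComplex (Rep.{u} k G)} (hS : S.ShortExact) (hT : T.ShortExact)
    (φ : S ⟶ T.map (resFunctor f)) (n : ℕ) (h₀ : Epi (map f φ.τ₁ (n + 1)))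
    (h₁ : IsIso (map f φ.τ₂ (n + 1)))
    (h₂ : IsIso (map f φ.τ₁ n)) (h₃ : Mono (map f φ.τ₂ n)) : IsIso (map f φ.τ₃ (n + 1)) := by
  refine HomologicalComplex.HomologySequence.isIso_homologyMap_τ₃ (chainsMapShortComplex f φ)
    (map_chainsFunctor_shortExact hS) (map_chainsFunctor_shortExact hT) (n + 1) h₀ h₁ ?_ ?_
  · intro j hj
    obtain rfl : j = n := by simpa using hj
    exact h₂
  · intro j hj
    obtain rfl : j = n := by simpa using hj
    exact h₃

theorem isZero_succ_of_idIsTrace [Fintype G] {A : Rep.{u} k G} (hA : A.IdIsTrace) (n : ℕ) :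
    Limits.IsZero (groupHomology A (n + 1)) :=
  let ⟨θ, hθ⟩ := hA
  isZero_succ_of_trace_eq_id A θ hθ n

theorem H0π_ρ_apply (A : Rep.{u} k G) (g : G) (a : A) : H0π A (A.ρ g a) = H0π A a := by
  rw [← coinvariantsMk_comp_H0Iso_inv]
  exact congrArg (H0Iso A).inv (Representation.Coinvariants.mk_self_apply A.ρ g a)

theorem H0π_map_apply {A : Rep.{u} k H} {B : Rep.{u} k G} (f : H →* G) (φ : A ⟶ res f B) (a : A) :
    map f φ 0 (H0π A a) = H0π B (φ.hom a) := by
  have := congrArg (fun ψ => ψ.hom a) (H0π_comp_map f φ)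
  exact this

section Conjugation

/-- The action of `g` on `A`, as a morphism covering the conjugation by `g`. -/
def conjHom (g : G) (A : Rep.{u} k G) : A ⟶ res (MulAut.conj g).toMonoidHom A :=
  homMk (B := res (MulAut.conj g).toMonoidHom A) (A.ρ g) fun h a => by
    simp [← Module.End.mul_apply, ← map_mul]

/-- Coinvariants settle degree `0`. For higher degrees, `A` is a quotient of the acyclic
`finsuppDiag G A`, so the connecting map to the homology of the kernel is injective and natural for
conjugation. -/
theorem map_conj_eq_id [Fintype G] (g : G) (A : Rep.{u} k G) (n : ℕ) :
    map (MulAut.conj g).toMonoidHom (conjHom g A) n = 𝟙 _ := by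
  induction n generalizing A with
  | zero =>
    ext x
    induction x using H0_induction_on with
    | h a =>
      refine (H0π_map_apply _ _ a).trans ?_
      exact H0π_ρ_apply A g a
  | succ n ih =>
    have hS := shortExact_kernel (diagSum G A)
    let φ : ShortComplex.mk _ _ (Limits.kernel.condition (diagSum G A)) ⟶
        (ShortComplex.mk _ _ (Limits.kernel.condition (diagSum G A))).map
          (resFunctor (MulAut.conj g).toMonoidHom) :=
      { τ₁ := conjHom g _
        τ₂ := conjHom g _
        τ₃ := conjHom g _
        comm₁₂ := hom_ext_apply fun a => (hom_comm_apply (Limits.kernel.ι (diagSum G A)) g a)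
        comm₂₃ := hom_ext_apply fun a => (hom_comm_apply (diagSum G A) g a) }
    have h := δ_comp_map _ hS hS φ n
    have hmono : Mono (δ hS (n + 1) n rfl) := mono_δ_of_isZero hS n <|
      isZero_succ_of_idIsTrace (idIsTrace_res_finsuppDiag (.id G) G id (fun _ _ => rfl) A) n
    rw [← cancel_mono (δ hS (n + 1) n rfl), Category.id_comp]
    refine h.symm.trans ?_
    rw [show map _ φ.τ₁ n = 𝟙 _ from ih _]
    exact Category.comp_id _

end Conjugation

section Shapiro

variable {X : Type u} [MulAction G X]

/-- The map `b ↦ b · x₀`, for a point `x₀` fixed by the image of `f`. -/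
def diagSingleHom (f : H →* G) (x₀ : X) (hx₀ : ∀ h, f h • x₀ = x₀) (B : Rep.{u} k G) :
    res f B ⟶ res f (finsuppDiag X B) :=
  homMk (A := res f B) (B := res f (finsuppDiag X B)) (diagSingle (B := B) x₀) fun h b => by
    refine Eq.trans ?_ (finsuppDiag_ρ_single B (f h) x₀ b).symm
    rw [hx₀]
    rfl

theorem isIso_map_diagSingleHom_zero (f : H →* G) (x₀ : X)
    (hx₀ : ∀ g : G, g • x₀ = x₀ ↔ g ∈ f.range) (hX : ∀ x : X, ∃ g : G, g • x₀ = x)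
    (B : Rep.{u} k G) :
    IsIso (map f (diagSingleHom f x₀ (fun h => (hx₀ _).2 ⟨h, rfl⟩) B) 0) := by
  choose s hs using hX
  have h1 : Function.Surjective
      (map f (diagSingleHom f x₀ (fun h => (hx₀ _).2 ⟨h, rfl⟩) B) 0) := by
    intro y
    induction y using H0_induction_on with
    | h a =>
      induction a using finsuppDiag_induction with
      | h0 => exact ⟨0, by simp⟩
      | hadd a b ha hb =>
        obtain ⟨a', ha'⟩ := ha
        obtain ⟨b', hb'⟩ := hb
        exact ⟨a' + b', by rw [map_add, map_add, ha', hb']⟩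
      | hs x b =>
        refine ⟨H0π (res f B) (B.ρ (s x)⁻¹ b), ?_⟩
        refine (H0π_map_apply _ _ _).trans ?_
        refine (H0π_ρ_apply _ (s x) _).symm.trans ?_
        refine congrArg _ ((finsuppDiag_ρ_single B (s x) x₀ _).trans ?_)
        rw [hs]
        simp [← Module.End.mul_apply, ← map_mul]
  have h2 : Function.Injective
      (map f (diagSingleHom f x₀ (fun h => (hx₀ _).2 ⟨h, rfl⟩) B) 0) := by
    -- A left inverse on coinvariants: transport the value at `x` back to `x₀` by `s x`. The choice
    -- of `s x` matters only up to the stabilizer, which coinvariants do not see.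
    let L₀ : finsuppDiag X B →ₗ[k] Representation.Coinvariants (res f B).ρ :=
      diagLift (B := B) fun x =>
        (Representation.Coinvariants.mk (res f B).ρ : B →ₗ[k] _) ∘ₗ B.ρ (s x)⁻¹
    have hL₀ (x : X) (b : B) : L₀ (diagSingle x b) =
        Representation.Coinvariants.mk (res f B).ρ (B.ρ (s x)⁻¹ b) := diagLift_single _ _ _
    have hL₀g (g : G) : L₀ ∘ₗ (finsuppDiag X B).ρ g = L₀ := by
      refine finsuppDiag_linearMap_ext fun x b => ?_
      rw [LinearMap.comp_apply, finsuppDiag_ρ_single, hL₀, hL₀]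
      obtain ⟨h, hh⟩ : (s (g • x))⁻¹ * g * s x ∈ f.range := by
        rw [← hx₀, mul_smul, hs, mul_smul, inv_smul_eq_iff, hs]
      rw [← Representation.Coinvariants.mk_self_apply (res f B).ρ h (B.ρ (s x)⁻¹ b)]
      refine congrArg _ ?_
      change _ = B.ρ (f h) _
      rw [hh]
      simp [← Module.End.mul_apply, ← map_mul]
    let L := Representation.Coinvariants.lift _ L₀ hL₀g
    have hL (b : B) : L ((H0Iso (finsuppDiag X B)).hom
        (map f (diagSingleHom f x₀ (fun h => (hx₀ _).2 ⟨h, rfl⟩) B) 0 (H0π (res f B) b))) =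
          (H0Iso (res f B)).hom (H0π (res f B) b) := by
      rw [H0π_map_apply, H0π_comp_H0Iso_hom_apply, H0π_comp_H0Iso_hom_apply]
      refine (hL₀ x₀ b).trans ?_
      obtain ⟨h, hh⟩ := (hx₀ (s x₀)⁻¹).1 (by rw [inv_smul_eq_iff, hs])
      rw [← hh]
      exact Representation.Coinvariants.mk_self_apply (res f B).ρ h b
    intro y y' hyy
    induction y using H0_induction_on with
    | h b =>
      induction y' using H0_induction_on with
      | h b' =>
        refine (ConcreteCategory.bijective_of_isIso (H0Iso (res f B)).hom).injective ?_
        rw [← hL b, ← hL b', hyy]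
  rw [ConcreteCategory.isIso_iff_bijective]
  exact ⟨h2, h1⟩

/-- Shapiro's lemma, for the explicit map given by the inclusion of a stabilizer. -/
theorem isIso_map_diagSingleHom [Fintype G] [Fintype H] (f : H →* G) (hf : Function.Injective f)
    (x₀ : X) (hx₀ : ∀ g : G, g • x₀ = x₀ ↔ g ∈ f.range) (hX : ∀ x : X, ∃ g : G, g • x₀ = x)
    (B : Rep.{u} k G) (n : ℕ) :
    IsIso (map f (diagSingleHom f x₀ (fun h => (hx₀ _).2 ⟨h, rfl⟩) B) n) := by
  induction n generalizing B with
  | zero => exact isIso_map_diagSingleHom_zero f x₀ hx₀ hX B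
  | succ n ih =>
    have hfix : ∀ h, f h • x₀ = x₀ := fun h => (hx₀ _).2 ⟨h, rfl⟩
    obtain ⟨c, hc⟩ := exists_equivariant_retraction f hf
    let S (B : Rep.{u} k G) := ShortComplex.mk _ _ (Limits.kernel.condition (diagSum G B))
    have hS (B) : (S B).ShortExact := shortExact_kernel (diagSum G B)
    have hS₁ (B) : ((S B).map (resFunctor f)).ShortExact := (shortExact_res f).2 (hS B)
    have hS₂ (B) : ((S B).map (finsuppDiagFunctor X)).ShortExact :=
      shortExact_map_finsuppDiagFunctor (hS B)
    let φ (B) : (S B).map (resFunctor f) ⟶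
        ((S B).map (finsuppDiagFunctor X)).map (resFunctor f) :=
      { τ₁ := diagSingleHom f x₀ hfix _
        τ₂ := diagSingleHom f x₀ hfix _
        τ₃ := diagSingleHom f x₀ hfix _
        comm₁₂ := hom_ext_apply fun a => finsuppDiagMap_single (S B).f x₀ a
        comm₂₃ := hom_ext_apply fun a => finsuppDiagMap_single (S B).g x₀ a }
    -- Both groups vanish: functions on `G` are free over `H` as well as over `G`, and a trace
    -- identity passes to `finsuppDiag X`.
    have hmid (B) : IsIso (map f (φ B).τ₂ (n + 1)) := by
      have z₁ := isZero_succ_of_idIsTrace (idIsTrace_res_finsuppDiag f G c hc B) n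
      have z₂ := isZero_succ_of_idIsTrace
        ((idIsTrace_res_finsuppDiag (.id G) G id (fun _ _ => rfl) B).finsuppDiag X) n
      exact Limits.IsZero.isIso z₁ z₂ _
    -- Surjectivity is needed for all coefficients first: the five lemma for `B` uses it for the
    -- kernel of `diagSum G B`.
    have hepi (B) : Epi (map f (φ B).τ₃ (n + 1)) := by
      have i₁ : IsIso (map f (φ B).τ₁ n) := ih _
      have i₂ : IsIso (map f (φ B).τ₂ n) := ih _
      have := hmid B
      exact epi_map_succ_τ₃ f (hS₁ B) (hS₂ B) (φ B) n inferInstance inferInstance inferInstance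
    have i₂ : IsIso (map f (φ B).τ₂ n) := ih _
    exact isIso_map_succ_τ₃ f (hS₁ B) (hS₂ B) (φ B) n (hepi _) (hmid B) (ih _) inferInstance

end Shapiro

end groupHomology

/-! ### Exactness of the complex of injective words -/

namespace Word

open Finsupp

variable {α : Type*}

/-- The alternating sum of the words obtained from `w` by deleting one letter. -/
def deletions : List α → (List α →₀ ℤ)
  | [] => 0
  | a :: w => single w 1 - lmapDomain ℤ ℤ (a :: ·) (deletions w)

/-- The boundary operator on the free abelian group on all words. -/
def boundary : (List α →₀ ℤ) →ₗ[ℤ] (List α →₀ ℤ) := linearCombination ℤ deletions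

theorem boundary_single (w : List α) (c : ℤ) : boundary (single w c) = c • deletions w := by
  simp [boundary]

theorem exists_of_deletions_ne_zero {w x : List α} (h : deletions w x ≠ 0) :
    ∃ l b r, w = l ++ b :: r ∧ x = l ++ r := by
  induction w generalizing x with
  | nil => simp [deletions] at h
  | cons a w ih =>
    classical
    by_cases hx : x = w
    · exact ⟨[], a, w, rfl, hx⟩
    · have h' : lmapDomain ℤ ℤ (a :: ·) (deletions w) x ≠ 0 := by
        simpa [deletions, single_apply, Ne.symm hx] using h
      rw [lmapDomain_apply] at h'
      obtain ⟨y, hy, rfl⟩ := Finset.mem_image.1 (mapDomain_support (mem_support_iff.2 h'))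
      obtain ⟨l, b, r, rfl, rfl⟩ := ih (mem_support_iff.1 hy)
      exact ⟨a :: l, b, r, rfl, rfl⟩

theorem deletions_append (u v : List α) :
    deletions (u ++ v) = lmapDomain ℤ ℤ (· ++ v) (deletions u) +
      (-1 : ℤ) ^ u.length • lmapDomain ℤ ℤ (u ++ ·) (deletions v) := by
  induction u with
  | nil =>
    simp only [List.nil_append, deletions, map_zero, zero_add, List.length_nil, pow_zero, one_smul]
    exact mapDomain_id.symm
  | cons a u ih =>
    simp only [List.cons_append, deletions, ih, map_sub, map_add, map_smul, lmapDomain_apply,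
      mapDomain_single, ← mapDomain_comp, List.length_cons, pow_succ]
    simp only [Function.comp_def, List.cons_append, mul_neg, mul_one, neg_smul]
    abel

/-- The cone formula: prepending `a` contracts the complex of all words. It leaves the injective
words as soon as `a` already occurs, which is the difficulty met below. -/
theorem boundary_cons (a : α) (z : List α →₀ ℤ) :
    boundary (lmapDomain ℤ ℤ (a :: ·) z) = z - lmapDomain ℤ ℤ (a :: ·) (boundary z) := by
  induction z using Finsupp.induction_linear with
  | zero => simp
  | add x y hx hy => simp only [map_add, hx, hy]; abel
  | single w c =>
    simp [mapDomain_single, boundary_single, deletions, smul_sub]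

theorem boundary_deletions (w : List α) : boundary (deletions w) = 0 := by
  induction w with
  | nil => simp [deletions]
  | cons a w ih =>
    rw [deletions, map_sub, boundary_cons, ih, boundary_single]
    simp

theorem boundary_boundary (z : List α →₀ ℤ) : boundary (boundary z) = 0 := by
  induction z using Finsupp.induction_linear with
  | zero => simp
  | add x y hx hy => simp only [map_add, hx, hy, add_zero]
  | single w c => rw [boundary_single, map_smul, boundary_deletions, smul_zero]

/-- The chains of words of length `p` with distinct letters in `s`. -/
def chains (s : Finset α) (p : ℕ) : Submodule ℤ (List α →₀ ℤ) :=
  supported ℤ ℤ {w | w.Nodup ∧ (∀ x ∈ w, x ∈ s) ∧ w.length = p}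

theorem mem_chains {s : Finset α} {p : ℕ} {z : List α →₀ ℤ} :
    z ∈ chains s p ↔ ∀ w, z w ≠ 0 → w.Nodup ∧ (∀ x ∈ w, x ∈ s) ∧ w.length = p := by
  rw [chains, mem_supported]
  exact ⟨fun h w hw => h (mem_support_iff.2 hw), fun h w hw => h w (mem_support_iff.1 hw)⟩

theorem exists_of_boundary_ne_zero {z : List α →₀ ℤ} {x : List α} (h : boundary z x ≠ 0) :
    ∃ l b r, z (l ++ b :: r) ≠ 0 ∧ x = l ++ r := by
  rw [boundary, linearCombination_apply, Finsupp.sum, Finsupp.finsetSum_apply] at h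
  obtain ⟨w, hw, hwx⟩ := Finset.exists_ne_zero_of_sum_ne_zero h
  obtain ⟨l, b, r, rfl, rfl⟩ := exists_of_deletions_ne_zero (w := w) (x := x) fun h0 => hwx <| by
    simp [h0]
  exact ⟨l, b, r, mem_support_iff.1 hw, rfl⟩

theorem boundary_mem_chains {s : Finset α} {p : ℕ} {z : List α →₀ ℤ} (hz : z ∈ chains s (p + 1)) :
    boundary z ∈ chains s p := by
  rw [mem_chains] at hz ⊢
  intro x hx
  obtain ⟨l, b, r, hw, rfl⟩ := exists_of_boundary_ne_zero hx
  obtain ⟨h1, h2, h3⟩ := hz _ hw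
  have hsub : (l ++ r).Sublist (l ++ b :: r) := (List.sublist_cons_self b r).append_left l
  refine ⟨h1.sublist hsub, fun x hx => h2 x (hsub.subset hx), ?_⟩
  simp at h3 ⊢
  omega

theorem lmapDomain_apply_of_injective {β γ : Type*} {f : β → γ} (hf : Function.Injective f)
    (z : β →₀ ℤ) (x : β) : lmapDomain ℤ ℤ f z (f x) = z x :=
  mapDomain_apply hf z x

theorem exists_of_lmapDomain_ne_zero {β γ : Type*} {f : β → γ} {z : β →₀ ℤ} {y : γ}
    (h : lmapDomain ℤ ℤ f z y ≠ 0) : ∃ x, z x ≠ 0 ∧ f x = y := by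
  classical
  obtain ⟨x, hx, rfl⟩ := Finset.mem_image.1 (mapDomain_support (mem_support_iff.2 h))
  exact ⟨x, mem_support_iff.1 hx, rfl⟩

/-- The coefficients of a chain at the words with the given prefix. -/
def coeffPrefix (u : List α) : (List α →₀ ℤ) →ₗ[ℤ] (List α →₀ ℤ) :=
  lcomapDomain (u ++ ·) (List.append_right_injective u)

@[simp]
theorem coeffPrefix_apply (u : List α) (z : List α →₀ ℤ) (v : List α) :
    coeffPrefix u z v = z (u ++ v) := rfl

/-- All occurrences of the letter `a` are at one of the first `j` positions. -/
def OccursBefore (a : α) (j : ℕ) (w : List α) : Prop :=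
  ∀ u v, w = u ++ a :: v → u.length < j

/-- A deletion that results in a word `u a x` must come from the tail of a word `u a v`: deleting at
or before this `a` would require an `a` one position further right in `w`, against the bound on its
position. Hence the tails after `u a` in a cycle form a cycle. -/
theorem coeffPrefix_deletions {a : α} {u w : List α} (hw : w.Nodup)
    (hj : OccursBefore a (u.length + 1) w) :
    coeffPrefix (u ++ [a]) (deletions w) =
      (-1 : ℤ) ^ (u.length + 1) • boundary (coeffPrefix (u ++ [a]) (single w 1)) := by
  classical
  by_cases h : ∃ v, w = u ++ a :: v
  · obtain ⟨v, rfl⟩ := h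
    have h1 : coeffPrefix (u ++ [a]) (single (u ++ a :: v) 1) = single v 1 := by
      ext x
      simp [single_apply]
    rw [h1, boundary_single, one_smul]
    ext x
    have h2 := DFunLike.congr_fun (deletions_append (u ++ [a]) v) ((u ++ [a]) ++ x)
    rw [coeffPrefix_apply, show u ++ a :: v = (u ++ [a]) ++ v by simp, h2, Finsupp.add_apply,
      Finsupp.smul_apply, Finsupp.smul_apply,
      lmapDomain_apply_of_injective (List.append_right_injective (u ++ [a]))]
    rw [List.length_append, List.length_singleton, add_eq_right]
    by_contra h3
    obtain ⟨y, hy, hyx⟩ := exists_of_lmapDomain_ne_zero h3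
    obtain ⟨l, b, r, hl, rfl⟩ := exists_of_deletions_ne_zero hy
    have hlen : (l ++ r).length = u.length := by
      have := congrArg List.length hl
      simp at this ⊢
      omega
    have h4 : (l ++ r) ++ v = u ++ (a :: x) := by simpa using hyx
    obtain ⟨-, rfl⟩ := List.append_inj h4 hlen
    rw [List.nodup_append] at hw
    simp at hw
  · have h1 : coeffPrefix (u ++ [a]) (single w 1) = 0 := by
      ext x
      rw [coeffPrefix_apply, single_apply, if_neg, Finsupp.zero_apply]
      rintro rfl
      exact h ⟨x, by simp⟩
    rw [h1, map_zero, smul_zero]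
    ext x
    rw [coeffPrefix_apply, Finsupp.zero_apply]
    by_contra h2
    obtain ⟨l, b, r, rfl, hx⟩ := exists_of_deletions_ne_zero h2
    have hx : u ++ a :: x = l ++ r := by simpa using hx
    rcases List.append_eq_append_iff.1 hx with ⟨l', rfl, hl'⟩ | ⟨u', rfl, rfl⟩
    · cases l' with
      | nil =>
        have := hj (u ++ [b]) x (by simp at hl'; simp [← hl'])
        simp at this
      | cons c l' =>
        simp at hl'
        obtain ⟨rfl, rfl⟩ := hl'
        exact h ⟨l' ++ b :: r, by simp⟩
    · have := hj (l ++ b :: u') x (by simp)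
      simp at this

theorem coeffPrefix_boundary {a : α} {u : List α} {z : List α →₀ ℤ}
    (hz : ∀ w, z w ≠ 0 → w.Nodup ∧ OccursBefore a (u.length + 1) w) :
    coeffPrefix (u ++ [a]) (boundary z) =
      (-1 : ℤ) ^ (u.length + 1) • boundary (coeffPrefix (u ++ [a]) z) := by
  have hz' : z ∈ supported ℤ ℤ {w | w.Nodup ∧ OccursBefore a (u.length + 1) w} :=
    (mem_supported ℤ z).2 fun w hw => hz w (mem_support_iff.1 hw)
  rw [supported_eq_span_single] at hz'
  clear hz
  induction hz' using Submodule.span_induction with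
  | mem x hx =>
    obtain ⟨w, ⟨hw, hj⟩, rfl⟩ := hx
    rw [boundary_single, one_smul, coeffPrefix_deletions hw hj]
  | zero => simp
  | add x y _ _ hx hy => simp only [map_add, hx, hy, smul_add]
  | smul c x _ hx => simp only [map_smul, hx, smul_comm c]

/-- Take `c = ± u a y`, where `y` fills the cycle of tails over the letters not in `u a`. Deleting
inside `y` reproduces the part of `z` with prefix `u a`; deleting inside `u a` moves `a` before
position `|u|` or removes it. -/
theorem exists_boundary_eq_on_prefix [DecidableEq α] {s : Finset α} {a : α} {p : ℕ}
    (hp : p < s.card)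
    (ih : ∀ t ⊂ s, ∀ q < t.card, ∀ z ∈ chains t q, boundary z = 0 →
      ∃ y ∈ chains t (q + 1), boundary y = z)
    {z : List α →₀ ℤ} (hz : z ∈ chains s p) (hb : boundary z = 0) (u : List α)
    (hu : ∀ w, z w ≠ 0 → OccursBefore a (u.length + 1) w) :
    ∃ c ∈ chains s (p + 1), ∀ u' v, u.length ≤ u'.length →
      boundary c (u' ++ a :: v) = if u' = u then z (u ++ a :: v) else 0 := by
  have hz' := mem_chains.1 hz
  by_cases h0 : coeffPrefix (u ++ [a]) z = 0
  · refine ⟨0, zero_mem _, fun u' v _ => ?_⟩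
    have := DFunLike.congr_fun h0 v
    simp at this
    simp [this]
  obtain ⟨v₀, hv₀⟩ := DFunLike.ne_iff.1 h0
  obtain ⟨hn, hs, hl⟩ := hz' _ hv₀
  have hua : (u ++ [a]).Nodup := (List.nodup_append.1 hn).1
  have hus : (u ++ [a]).toFinset ⊆ s := fun x hx => hs x (by simp at hx ⊢; tauto)
  have hcard : (u ++ [a]).toFinset.card = u.length + 1 := by
    rw [List.toFinset_card_of_nodup hua]; simp
  have hl' : u.length + 1 + v₀.length = p := by simp at hl; omega
  have hzu : coeffPrefix (u ++ [a]) z ∈ chains (s \ (u ++ [a]).toFinset) v₀.length := by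
    rw [mem_chains]
    intro v hv
    obtain ⟨hn, hs, hl⟩ := hz' _ hv
    rw [List.nodup_append] at hn
    refine ⟨hn.2.1, fun x hx => Finset.mem_sdiff.2 ⟨hs x (List.mem_append_right _ hx), fun hx' =>
      hn.2.2 x (List.mem_toFinset.1 hx') x hx rfl⟩, ?_⟩
    simp at hl
    omega
  obtain ⟨y, hy, hyz⟩ := ih (s \ (u ++ [a]).toFinset)
    (Finset.sdiff_ssubset hus ⟨a, by simp⟩) v₀.length
    (by rw [Finset.card_sdiff_of_subset hus, hcard]; omega) _ hzu (by
      have := coeffPrefix_boundary (a := a) (u := u) (z := z) fun w hw => ⟨(hz' w hw).1, hu w hw⟩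
      rw [hb, map_zero] at this
      rcases smul_eq_zero.1 this.symm with h | h
      · simp at h
      · exact h)
  have hy' := mem_chains.1 hy
  refine ⟨(-1 : ℤ) ^ (u.length + 1) • lmapDomain ℤ ℤ ((u ++ [a]) ++ ·) y,
    Submodule.smul_mem _ _ ?_, ?_⟩
  · rw [mem_chains]
    intro w hw
    obtain ⟨v, hv, rfl⟩ := exists_of_lmapDomain_ne_zero hw
    obtain ⟨hvn, hvs, hvl⟩ := hy' v hv
    refine ⟨List.nodup_append.2 ⟨hua, hvn, ?_⟩, ?_, ?_⟩
    · rintro x hx _ hxv rfl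
      exact (Finset.mem_sdiff.1 (hvs x hxv)).2 (List.mem_toFinset.2 hx)
    · intro x hx
      rcases List.mem_append.1 hx with hx | hx
      · exact hus (List.mem_toFinset.2 hx)
      · exact (Finset.mem_sdiff.1 (hvs x hx)).1
    · simp only [List.length_append, List.length_singleton]
      omega
  · have hexp : ∀ z : List α →₀ ℤ, boundary (lmapDomain ℤ ℤ ((u ++ [a]) ++ ·) z) =
        linearCombination ℤ (fun v => lmapDomain ℤ ℤ (· ++ v) (deletions (u ++ [a]))) z +
          (-1 : ℤ) ^ (u.length + 1) • lmapDomain ℤ ℤ ((u ++ [a]) ++ ·) (boundary z) := by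
      intro z
      induction z using Finsupp.induction_linear with
      | zero => simp
      | add x y hx hy =>
        simp only [map_add, hx, hy, smul_add]
        abel
      | single w c =>
        rw [lmapDomain_apply, mapDomain_single, boundary_single, deletions_append, boundary_single,
          linearCombination_single, map_smul, smul_add, smul_comm c, List.length_append,
          List.length_singleton]
    intro u' v hu'
    rw [map_smul, hexp, hyz, smul_add, smul_smul, ← mul_pow]
    simp only [mul_neg, mul_one, neg_neg, one_pow, one_smul, Finsupp.add_apply, Finsupp.smul_apply]
    -- After a deletion in `u a` only `|u|` letters precede the tail, so an `a` at position `|u|` or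
    -- later would lie in the tail, which avoids `a`.
    have hzero : linearCombination ℤ (fun v => lmapDomain ℤ ℤ (· ++ v) (deletions (u ++ [a]))) y
        (u' ++ a :: v) = 0 := by
      by_contra h
      rw [linearCombination_apply, Finsupp.sum, Finsupp.finsetSum_apply] at h
      obtain ⟨x, hx, hxv⟩ := Finset.exists_ne_zero_of_sum_ne_zero h
      rw [Finsupp.smul_apply, smul_ne_zero_iff] at hxv
      obtain ⟨t, ht, htx⟩ := exists_of_lmapDomain_ne_zero hxv.2
      obtain ⟨l, b, r, hlr, rfl⟩ := exists_of_deletions_ne_zero ht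
      have hlen : (l ++ r).length = u.length := by
        have := congrArg List.length hlr
        simp at this ⊢
        omega
      have hax : a ∈ x := by
        rcases List.append_eq_append_iff.1 htx with ⟨l', rfl, rfl⟩ | ⟨r', h1, h2⟩
        · simp
        · have h3 := congrArg List.length h1
          rw [List.length_append (bs := r')] at h3
          have : r' = [] := List.eq_nil_of_length_eq_zero (by omega)
          subst this
          simp at h2
          simp [← h2]
      exact (Finset.mem_sdiff.1 ((hy' x hxv.1).2.1 a hax)).2 (by simp)
    rw [hzero, smul_zero, zero_add]
    split_ifs with h
    · subst h
      rw [show u' ++ a :: v = (u' ++ [a]) ++ v by simp,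
        lmapDomain_apply_of_injective (List.append_right_injective (u' ++ [a])), coeffPrefix_apply]
    · by_contra h1
      obtain ⟨x, hx, hxv⟩ := exists_of_lmapDomain_ne_zero h1
      have h2 : u' ++ a :: v = u ++ a :: x := by simpa using hxv.symm
      have hocc := hu (u ++ a :: x) (by simpa using hx) u' v h2.symm
      exact h (List.append_inj h2 (by omega)).1

theorem exists_homologous_occursBefore [DecidableEq α] {s : Finset α} {a : α} {p : ℕ}
    (hp : p < s.card)
    (ih : ∀ t ⊂ s, ∀ q < t.card, ∀ z ∈ chains t q, boundary z = 0 →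
      ∃ y ∈ chains t (q + 1), boundary y = z) (j : ℕ)
    {z : List α →₀ ℤ} (hz : z ∈ chains s p) (hb : boundary z = 0)
    (hu : ∀ w, z w ≠ 0 → OccursBefore a (j + 1) w) :
    ∃ c ∈ chains s (p + 1), ∀ w, (z - boundary c) w ≠ 0 → OccursBefore a j w := by
  -- Induction over a finite set `U` containing the prefixes `u` of length `j` still to be cleared;
  -- clearing one creates no new ones.
  have key : ∀ U : Finset (List α), ∀ z ∈ chains s p, boundary z = 0 →
      (∀ w, z w ≠ 0 → OccursBefore a (j + 1) w) →
      (∀ u v, u.length = j → z (u ++ a :: v) ≠ 0 → u ∈ U) →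
      ∃ c ∈ chains s (p + 1), ∀ w, (z - boundary c) w ≠ 0 → OccursBefore a j w := by
    intro U
    induction U using Finset.induction_on with
    | empty =>
      intro z hz hb hu hU
      refine ⟨0, zero_mem _, fun w hw u v hw' => ?_⟩
      rw [map_zero, sub_zero] at hw
      have h1 := hu w hw u v hw'
      have h2 : u.length ≠ j := fun h => by simpa using hU u v h (hw' ▸ hw)
      omega
    | insert u U _ ihU =>
      intro z hz hb hu hU
      by_cases huj : u.length = j
      · obtain ⟨c, hc, hcb⟩ := exists_boundary_eq_on_prefix hp ih hz hb u (huj ▸ hu)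
        rw [huj] at hcb
        have hval : ∀ u' v, j ≤ u'.length → (z - boundary c) (u' ++ a :: v) ≠ 0 →
            u' ≠ u ∧ z (u' ++ a :: v) ≠ 0 := by
          intro u' v hu' hne
          rw [Finsupp.sub_apply, hcb u' v hu'] at hne
          split_ifs at hne with h
          · subst h; simp at hne
          · exact ⟨h, by simpa using hne⟩
        obtain ⟨c', hc', hcb'⟩ := ihU (z - boundary c)
          (sub_mem hz (boundary_mem_chains hc)) (by rw [map_sub, hb, boundary_boundary, sub_zero])
          (by
            intro w hw u' v hw'
            by_contra hlt
            subst hw'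
            exact hlt (hu _ (hval u' v (by omega) hw).2 u' v rfl))
          (by
            intro u' v hu' hne
            have := hval u' v hu'.ge hne
            exact (Finset.mem_insert.1 (hU u' v hu' this.2)).resolve_left this.1)
        refine ⟨c + c', add_mem hc hc', ?_⟩
        rw [map_add, ← sub_sub]
        exact hcb'
      · exact ihU z hz hb hu fun u' v hu' hne =>
          (Finset.mem_insert.1 (hU u' v hu' hne)).resolve_left fun h => huj (h ▸ hu')
  refine key (z.support.image (List.take j)) z hz hb hu fun u v huj hne => ?_
  exact Finset.mem_image.2 ⟨_, mem_support_iff.2 hne, by simp [← huj]⟩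

/-- A cycle of words with distinct letters in `s`, of length less than the number of letters, is a
boundary of such words. -/
theorem exists_boundary_eq [DecidableEq α] (s : Finset α) (p : ℕ) (hp : p < s.card)
    (z : List α →₀ ℤ) (hz : z ∈ chains s p) (hb : boundary z = 0) :
    ∃ y ∈ chains s (p + 1), boundary y = z := by
  induction s using Finset.strongInduction generalizing p z with
  | H s ih =>
    obtain ⟨a, ha⟩ : s.Nonempty := Finset.card_pos.1 (by omega)
    have key : ∀ j, ∀ z ∈ chains s p, boundary z = 0 → (∀ w, z w ≠ 0 → OccursBefore a j w) →
        ∃ y ∈ chains s (p + 1), boundary y = z := by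
      intro j
      induction j with
      | zero =>
        intro z hz hb hocc
        -- With `j = 0` the letter `a` does not occur, so the cone with apex `a` consists of
        -- injective words.
        refine ⟨lmapDomain ℤ ℤ (a :: ·) z, ?_, by rw [boundary_cons, hb, map_zero, sub_zero]⟩
        rw [mem_chains] at hz ⊢
        intro w hw
        obtain ⟨v, hv, rfl⟩ := exists_of_lmapDomain_ne_zero hw
        obtain ⟨h1, h2, h3⟩ := hz v hv
        refine ⟨List.nodup_cons.2 ⟨fun hav => ?_, h1⟩, by simpa using ⟨ha, h2⟩, by simp [h3]⟩
        obtain ⟨l, r, rfl⟩ := List.append_of_mem hav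
        simpa using hocc _ hv l r rfl
      | succ j ihj =>
        intro z hz hb hocc
        obtain ⟨c, hc, hcz⟩ := exists_homologous_occursBefore hp
          (fun t ht q hq z hz hb => ih t ht q hq z hz hb) j hz hb hocc
        obtain ⟨y, hy, hyz⟩ := ihj _ (sub_mem hz (boundary_mem_chains hc))
          (by rw [map_sub, hb, boundary_boundary, sub_zero]) hcz
        exact ⟨y + c, add_mem hy hc, by rw [map_add, hyz, sub_add_cancel]⟩
    refine key p z hz hb fun w hw u v hw' => ?_
    have := (mem_chains.1 hz w hw).2.2
    rw [hw', List.length_append, List.length_cons] at this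
    omega

end Word

/-! ### Injective words as embeddings, and sphericity -/

namespace InjectiveWord

open Finsupp

/-- The `i`-th face of an injective word. -/
abbrev face {n p : ℕ} (i : Fin (p + 1)) (x : Fin (p + 1) ↪ Fin n) : Fin p ↪ Fin n :=
  (Fin.succAboveEmb i).trans x

/-- The boundary operator of the augmented complex of injective words. -/
def boundary (n p : ℕ) : ((Fin (p + 1) ↪ Fin n) →₀ ℤ) →ₗ[ℤ] ((Fin p ↪ Fin n) →₀ ℤ) :=
  ∑ i : Fin (p + 1), (-1 : ℤ) ^ (i : ℕ) • lmapDomain ℤ ℤ (face i)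

theorem boundary_single (n p : ℕ) (x : Fin (p + 1) ↪ Fin n) (a : ℤ) :
    boundary n p (single x a) = ∑ i : Fin (p + 1), (-1 : ℤ) ^ (i : ℕ) • single (face i x) a := by
  simp [boundary, LinearMap.sum_apply, mapDomain_single]

theorem deletions_ofFn {α : Type*} {p : ℕ} (x : Fin (p + 1) → α) :
    Word.deletions (List.ofFn x) =
      ∑ i : Fin (p + 1), (-1 : ℤ) ^ (i : ℕ) • single (List.ofFn fun j => x (i.succAbove j)) 1 := by
  induction p with
  | zero => simp [Word.deletions]
  | succ p ih =>
    rw [List.ofFn_succ, Word.deletions, ih, Fin.sum_univ_succ (n := p + 1), map_sum]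
    simp only [Fin.succAbove_zero, Fin.val_zero, pow_zero, one_smul, Fin.val_succ, map_smul,
      lmapDomain_apply, mapDomain_single, List.ofFn_succ (n := p), Fin.succ_succAbove_zero,
      Fin.succ_succAbove_succ, pow_succ, mul_neg, mul_one, neg_smul, Finset.sum_neg_distrib]
    rw [sub_eq_add_neg]

/-- The word underlying an injection. -/
def toWord (n p : ℕ) : ((Fin p ↪ Fin n) →₀ ℤ) →ₗ[ℤ] (List (Fin n) →₀ ℤ) :=
  lmapDomain ℤ ℤ fun x => List.ofFn x

theorem toWord_single (n p : ℕ) (x : Fin p ↪ Fin n) (a : ℤ) :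
    toWord n p (single x a) = single (List.ofFn x) a := by
  simp [toWord, mapDomain_single]

theorem toWord_injective (n p : ℕ) : Function.Injective (toWord n p) :=
  mapDomain_injective fun _ _ h => DFunLike.coe_injective (List.ofFn_injective h)

theorem toWord_mem_chains (n p : ℕ) (z) : toWord n p z ∈ Word.chains Finset.univ p := by
  rw [Word.mem_chains]
  intro w hw
  obtain ⟨x, -, rfl⟩ := Word.exists_of_lmapDomain_ne_zero hw
  exact ⟨List.nodup_ofFn.2 x.injective, by simp, by simp⟩

theorem exists_toWord_eq {n p : ℕ} {z : List (Fin n) →₀ ℤ} (hz : z ∈ Word.chains Finset.univ p) :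
    ∃ y, toWord n p y = z := by
  rw [Word.chains, supported_eq_span_single] at hz
  induction hz using Submodule.span_induction with
  | mem z hz =>
    obtain ⟨w, ⟨hw, -, rfl⟩, rfl⟩ := hz
    exact ⟨single ⟨w.get, List.nodup_iff_injective_get.1 hw⟩ 1, by simp [toWord_single]⟩
  | zero => exact ⟨0, map_zero _⟩
  | add x y _ _ hx hy =>
    obtain ⟨x', rfl⟩ := hx
    obtain ⟨y', rfl⟩ := hy
    exact ⟨x' + y', map_add _ _ _⟩
  | smul c x _ hx =>
    obtain ⟨x', rfl⟩ := hx
    exact ⟨c • x', map_smul _ _ _⟩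

theorem boundary_toWord (n p : ℕ) (z) :
    Word.boundary (toWord n (p + 1) z) = toWord n p (boundary n p z) := by
  induction z using Finsupp.induction_linear with
  | zero => simp
  | add x y hx hy => simp only [map_add, hx, hy]
  | single x a =>
    rw [toWord_single, Word.boundary_single, deletions_ofFn, boundary_single, map_sum,
      Finset.smul_sum]
    refine Finset.sum_congr rfl fun i _ => ?_
    rw [map_smul, toWord_single, smul_comm, smul_single_one]
    rfl

theorem boundary_boundary (n p : ℕ) (z) : boundary n p (boundary n (p + 1) z) = 0 :=
  toWord_injective n p <| by
    rw [← boundary_toWord, ← boundary_toWord, Word.boundary_boundary, map_zero]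

theorem exists_boundary_eq_of_word_boundary {n p : ℕ} (hp : p < n) (z : (Fin p ↪ Fin n) →₀ ℤ)
    (hz : Word.boundary (toWord n p z) = 0) : ∃ y, boundary n p y = z := by
  obtain ⟨y, hy, hyz⟩ := Word.exists_boundary_eq Finset.univ p (by simpa using hp) _
    (toWord_mem_chains n p z) hz
  obtain ⟨y, rfl⟩ := exists_toWord_eq hy
  exact ⟨y, toWord_injective n p (by rw [← boundary_toWord, hyz])⟩

theorem exists_boundary_eq {n p : ℕ} (hp : p + 1 < n) (z : (Fin (p + 1) ↪ Fin n) →₀ ℤ)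
    (hz : boundary n p z = 0) : ∃ y, boundary n (p + 1) y = z :=
  exists_boundary_eq_of_word_boundary hp z (by rw [boundary_toWord, hz, map_zero])

theorem boundary_zero_surjective {n : ℕ} (hn : 0 < n) : Function.Surjective (boundary n 0) := by
  intro z
  refine exists_boundary_eq_of_word_boundary hn z ?_
  induction z using Finsupp.induction_linear with
  | zero => simp
  | add x y hx hy => simp only [map_add, hx, hy, add_zero]
  | single x a => simp [toWord_single, Word.boundary_single, Word.deletions]

/-- Identifies the free group on the empty word with the augmentation term `ℤ`. -/
theorem boundary_zero_eq_augmentation (n : ℕ) (z : (Fin 1 ↪ Fin n) →₀ ℤ) :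
    boundary n 0 z = single default ((orderedSubsetComplex n).augmentation z) := by
  induction z using Finsupp.induction_linear with
  | zero => exact (boundary n 0).map_zero.trans (single_zero _).symm
  | add x y hx hy =>
    rw [map_add, hx, hy, ← single_add]
    exact congrArg _ (map_add (orderedSubsetComplex n).augmentation x y).symm
  | single x a =>
    rw [boundary_single, Fin.sum_univ_one, Fin.val_zero, pow_zero, one_smul]
    have h : (orderedSubsetComplex n).augmentation (single x a) = a • (1 : ℤ) :=
      linearCombination_single ℤ a x
    refine Eq.trans ?_ (congrArg (single default) (h.trans (mul_one a))).symm
    exact congrArg (fun y => single y a) (Subsingleton.elim _ _)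

end InjectiveWord

theorem isSpherical_orderedSubsetComplex (m : ℕ) :
    (orderedSubsetComplex (m + 1)).IsSpherical m := by
  refine ⟨⟨⟨fun _ => 0, fun _ _ _ => Subsingleton.elim (α := Fin 1) _ _⟩⟩, fun i hi => ?_⟩
  apply ChainComplex.isZero_homology_succ_of_exact
  intro x hx
  have hd (j : ℕ) : (orderedSubsetComplex (m + 1)).augmentedChainComplex.d (j + 2) (j + 1) =
      ModuleCat.ofHom ((orderedSubsetComplex (m + 1)).boundary j) :=
    ChainComplex.of_d (fun k => ModuleCat.of ℤ ((orderedSubsetComplex (m + 1)).Simplex k →₀ ℤ))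
      (fun k => ModuleCat.ofHom ((orderedSubsetComplex (m + 1)).boundary k)) j
  rw [hd]
  change (Fin (i + 1) ↪ Fin (m + 1)) →₀ ℤ at x
  rcases lt_or_gt_of_ne hi with hi | hi
  · have hx' : InjectiveWord.boundary (m + 1) i x = 0 := by
      cases i with
      | zero =>
        rw [InjectiveWord.boundary_zero_eq_augmentation]
        refine (congrArg _ ?_).trans (Finsupp.single_zero _)
        exact hx
      | succ i =>
        rw [hd] at hx
        exact hx
    exact InjectiveWord.exists_boundary_eq (by omega) x hx'
  · have : IsEmpty (Fin (i + 1) ↪ Fin (m + 1)) :=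
      ⟨fun f => by
        have := Fintype.card_le_of_embedding f
        simp only [Fintype.card_fin] at this
        omega⟩
    exact ⟨0, Subsingleton.elim (α := (Fin (i + 1) ↪ Fin (m + 1)) →₀ ℤ) _ _⟩

theorem CategoryTheory.isIso_iff_of_comp_eq_comp {C : Type*} [Category C] {W X Y Z : C}
    {a : W ⟶ X} {b : Y ⟶ Z} {x : X ⟶ Z} {y : W ⟶ Y} (ha : IsIso a) (hb : IsIso b)
    (h : a ≫ x = y ≫ b) : IsIso x ↔ IsIso y := by
  rw [← isIso_comp_left_iff a x, h, isIso_comp_right_iff]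

/-! ### Additivity of homology in the coefficients -/

namespace groupHomology

open Rep

variable {k G H : Type u} [CommRing k] [Group G] [Group H]

/-- The map on homology induced by a morphism of coefficients. -/
abbrev coeffMap {A B : Rep.{u} k G} (φ : A ⟶ B) (n : ℕ) : groupHomology A n ⟶ groupHomology B n :=
  map (.id G) φ n

theorem coeffMap_add {A B : Rep.{u} k G} (φ ψ : A ⟶ B) (n : ℕ) :
    coeffMap (φ + ψ) n = coeffMap φ n + coeffMap ψ n := by
  have h : chainsMap (.id G) (φ + ψ) = chainsMap (.id G) φ + chainsMap (.id G) ψ := by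
    refine HomologicalComplex.hom_ext _ _ fun i => ModuleCat.hom_ext <|
      Finsupp.lhom_ext fun x a => ?_
    refine (chainsMap_f_single _ _ _ x a).trans ?_
    refine (Finsupp.single_add _ _ _).trans ?_
    exact (congrArg₂ (· + ·) (chainsMap_f_single (B := B) (.id G) φ _ x a)
      (chainsMap_f_single (B := B) (.id G) ψ _ x a)).symm
  exact (congrArg (HomologicalComplex.homologyMap · n) h).trans
    (HomologicalComplex.homologyMap_add _ _ n)

instance (n : ℕ) : (functor k G n).Additive where
  map_add {_ _ φ ψ} := coeffMap_add φ ψ n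

theorem map_comp_coeffMap {A : Rep.{u} k H} {B C : Rep.{u} k G} (f : H →* G) (φ : A ⟶ res f B)
    (ψ : B ⟶ C) (n : ℕ) :
    map f φ n ≫ coeffMap ψ n = map f (φ ≫ (resFunctor f).map ψ) n :=
  (map_comp f (.id G) φ ψ n).symm

end groupHomology

/-! ### The boundary maps on the homology of the symmetric group -/

namespace InjectiveWord

open Rep groupHomology SymmetricGroup

/-- The representation of the symmetric group on the injective words of length `p`. -/
abbrev wordRep (n p : ℕ) : Rep ℤ (Equiv.Perm (Fin n)) :=
  finsuppDiag (Fin p ↪ Fin n) (Rep.trivial ℤ (Equiv.Perm (Fin n)) ℤ)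

theorem face_smul {n p : ℕ} (i : Fin (p + 1)) (g : Equiv.Perm (Fin n)) (x : Fin (p + 1) ↪ Fin n) :
    face i (g • x) = g • face i x := rfl

/-- The `i`-th face map, as a morphism of representations. -/
def faceHom (n : ℕ) {p : ℕ} (i : Fin (p + 1)) : wordRep n (p + 1) ⟶ wordRep n p :=
  homMk (diagLift fun x => diagSingle (face i x)) <|
    diagLift_equivariant _ fun g x b => by rw [face_smul, finsuppDiag_ρ_single]

theorem faceHom_single (n : ℕ) {p : ℕ} (i : Fin (p + 1)) (x : Fin (p + 1) ↪ Fin n) (b : ℤ) :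
    (faceHom n i).hom (diagSingle (B := Rep.trivial ℤ (Equiv.Perm (Fin n)) ℤ) x b) =
      diagSingle (B := Rep.trivial ℤ (Equiv.Perm (Fin n)) ℤ) (face i x) b :=
  diagLift_single _ _ _

/-- The boundary operator, as a morphism of representations. -/
def boundaryHom (n p : ℕ) : wordRep n (p + 1) ⟶ wordRep n p :=
  ∑ i : Fin (p + 1), (-1 : ℤ) ^ (i : ℕ) • faceHom n i

theorem boundaryHom_apply (n p : ℕ) (z : (Fin (p + 1) ↪ Fin n) →₀ ℤ) :
    (boundaryHom n p).hom z = boundary n p z := by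
  have h : (boundaryHom n p).hom.toLinearMap = boundary n p := by
    refine finsuppDiag_linearMap_ext fun x b => ?_
    refine Eq.trans ?_ (boundary_single n p x b).symm
    rw [boundaryHom, Rep.sum_hom]
    refine (Representation.IntertwiningMap.sum_apply _ _ _ _ _).trans ?_
    refine Finset.sum_congr rfl fun i _ => ?_
    exact congrArg ((-1 : ℤ) ^ (i : ℕ) • ·) (faceHom_single n i x b)
  exact LinearMap.congr_fun h z

/-- The morphism of representations given by a word that is fixed by the group. -/
def pointHom {H : Type} [Group H] {n p : ℕ} (f : H →* Equiv.Perm (Fin n)) (x : Fin p ↪ Fin n)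
    (hx : ∀ h, f h • x = x) : Rep.trivial ℤ H ℤ ⟶ res f (wordRep n p) :=
  diagSingleHom f x hx (Rep.trivial ℤ (Equiv.Perm (Fin n)) ℤ)

section

variable {H : Type} [Group H] {n p : ℕ} (f : H →* Equiv.Perm (Fin n))

theorem map_pointHom_faceHom (x : Fin (p + 1) ↪ Fin n) (hx : ∀ h, f h • x = x) (i : Fin (p + 1))
    (q : ℕ) :
    map f (pointHom f x hx) q ≫ coeffMap (faceHom n i) q =
      map f (pointHom f (face i x) fun h => by rw [← face_smul, hx]) q := by
  rw [map_comp_coeffMap]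
  exact map_congr rfl (LinearMap.ext fun b => faceHom_single n i x b) q

theorem map_pointHom_congr {f f' : H →* Equiv.Perm (Fin n)} (hf : f = f') (x : Fin p ↪ Fin n)
    (hx : ∀ h, f h • x = x) (q : ℕ) :
    map f (pointHom f x hx) q = map f' (pointHom f' x (hf ▸ hx)) q := by
  subst hf
  rfl

/-- Conjugation by `g` is trivial on homology, fixes `f` by commutation, and carries the point `x`
to `g • x`. -/
theorem map_pointHom_smul (x : Fin p ↪ Fin n) (hx : ∀ h, f h • x = x) (g : Equiv.Perm (Fin n))
    (hg : ∀ h, Commute g (f h)) (q : ℕ) :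
    map f (pointHom f (g • x) fun h => by rw [smul_smul, ← (hg h).eq, mul_smul, hx]) q =
      map f (pointHom f x hx) q := by
  have h1 := map_comp f (MulAut.conj g).toMonoidHom (pointHom f x hx) (conjHom g (wordRep n p)) q
  rw [map_conj_eq_id, Category.comp_id] at h1
  rw [← h1]
  refine map_congr ?_ ?_ q
  · ext1 h
    simp [(hg h).eq]
  · refine LinearMap.ext fun b => ?_
    exact (finsuppDiag_ρ_single (Rep.trivial ℤ (Equiv.Perm (Fin n)) ℤ) g x b).symm

theorem stabilization_comp_map_pointHom {m : ℕ} (f : Equiv.Perm (Fin (m + 1)) →* Equiv.Perm (Fin n))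
    (x : Fin p ↪ Fin n) (hx : ∀ h, f h • x = x) (q : ℕ) :
    homologyStabilization m q ≫ map f (pointHom f x hx) q =
      map (f.comp (stabilization m)) (pointHom _ x fun _ => hx _) q := by
  rw [homologyStabilization, ← map_comp]
  exact map_congr rfl rfl q

end

section complement

variable {n m p : ℕ}

theorem viaEmbeddingHom_smul_eq (j : Fin m ↪ Fin n) (e : Fin p ↪ Fin n)
    (h : ∀ y, y ∈ Set.range j ↔ y ∉ Set.range e) (σ : Equiv.Perm (Fin m)) :
    Equiv.Perm.viaEmbeddingHom j σ • e = e := by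
  ext i
  have : e i ∉ Set.range j := fun hi => (h _).1 hi ⟨i, rfl⟩
  exact congrArg Fin.val (Equiv.Perm.viaEmbedding_apply_of_notMem σ j (e i) this)

theorem smul_eq_iff_mem_range (j : Fin m ↪ Fin n) (e : Fin p ↪ Fin n)
    (h : ∀ y, y ∈ Set.range j ↔ y ∉ Set.range e) (g : Equiv.Perm (Fin n)) :
    g • e = e ↔ g ∈ (Equiv.Perm.viaEmbeddingHom j).range := by
  constructor
  · intro hg
    have hge (i : Fin p) : g (e i) = e i := DFunLike.congr_fun hg i
    have hmem (y : Fin n) : y ∈ Set.range j ↔ g y ∈ Set.range j := by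
      rw [h, h, not_iff_not]
      constructor
      · rintro ⟨i, rfl⟩
        exact ⟨i, (hge i).symm⟩
      · rintro ⟨i, hi⟩
        exact ⟨i, g.injective ((hge i).trans hi)⟩
    choose τ hτ using fun i => (hmem (j i)).1 ⟨i, rfl⟩
    have hinj : Function.Injective τ := fun a b hab =>
      j.injective (g.injective (by rw [← hτ, ← hτ, hab]))
    refine ⟨Equiv.ofBijective τ (Finite.injective_iff_bijective.1 hinj), Equiv.ext fun y => ?_⟩
    by_cases hy : y ∈ Set.range j
    · obtain ⟨i, rfl⟩ := hy
      exact (Equiv.Perm.viaEmbedding_apply _ j i).trans (hτ i)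
    · refine (Equiv.Perm.viaEmbedding_apply_of_notMem _ j y hy).trans ?_
      obtain ⟨i, rfl⟩ := not_not.1 (mt (h y).2 hy)
      exact (hge i).symm
  · rintro ⟨σ, rfl⟩
    exact viaEmbeddingHom_smul_eq j e h σ

/-- Shapiro's lemma for the word `e`: its stabilizer is the symmetric group of the complementary
letters, embedded through `j`, and the action on words is transitive. -/
theorem isIso_map_pointHom (j : Fin m ↪ Fin n) (e : Fin p ↪ Fin n)
    (h : ∀ y, y ∈ Set.range j ↔ y ∉ Set.range e) (q : ℕ) :
    IsIso (map (Equiv.Perm.viaEmbeddingHom j)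
      (pointHom _ e (viaEmbeddingHom_smul_eq j e h)) q) := by
  refine isIso_map_diagSingleHom (Equiv.Perm.viaEmbeddingHom j)
    (Equiv.Perm.viaEmbeddingHom_injective j) e (smul_eq_iff_mem_range j e h) (fun x => ?_)
    (Rep.trivial ℤ (Equiv.Perm (Fin n)) ℤ) q
  obtain ⟨g, hg⟩ := Equiv.Perm.exists_extending_pair e x e.injective x.injective
  exact ⟨g, DFunLike.ext _ _ fun i => hg i⟩

end complement

theorem sum_neg_one_pow_fin (p : ℕ) :
    ∑ i : Fin (p + 1), (-1 : ℤ) ^ (i : ℕ) = if Even p then 1 else 0 := by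
  rw [Fin.sum_univ_eq_sum_range (fun i => (-1 : ℤ) ^ i), neg_one_geom_sum]
  by_cases h : Even p <;> simp [h, Nat.even_add_one]

section stabilization

variable {n m p : ℕ}

theorem map_pointHom_face_eq (j : Fin m ↪ Fin n) (e : Fin (p + 1) ↪ Fin n)
    (h : ∀ y, y ∈ Set.range j ↔ y ∉ Set.range e) (i : Fin (p + 1)) (q : ℕ) :
    map (Equiv.Perm.viaEmbeddingHom j) (pointHom _ (face i e) fun σ => by
      rw [← face_smul, viaEmbeddingHom_smul_eq j e h]) q =
    map (Equiv.Perm.viaEmbeddingHom j) (pointHom _ (face 0 e) fun σ => by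
      rw [← face_smul, viaEmbeddingHom_smul_eq j e h]) q := by
  -- A cycle of the letters of `e` turns one face into the other; it is disjoint from the
  -- permutations of the range of `j`.
  have hg : face i e = Equiv.Perm.viaEmbedding i.cycleRange.symm e • face 0 e := by
    refine DFunLike.ext _ _ fun l => ?_
    refine Eq.trans ?_ (Equiv.Perm.viaEmbedding_apply i.cycleRange.symm e _).symm
    refine congrArg e ?_
    exact (Fin.cycleRange_symm_succ i l).symm
  have hc : ∀ σ, Commute (Equiv.Perm.viaEmbedding i.cycleRange.symm e)
      (Equiv.Perm.viaEmbeddingHom j σ) := by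
    refine fun σ => Equiv.Perm.Disjoint.commute fun y => ?_
    by_cases hy : y ∈ Set.range e
    · exact Or.inr (Equiv.Perm.viaEmbedding_apply_of_notMem _ _ _ fun hy' => (h y).1 hy' hy)
    · exact Or.inl (Equiv.Perm.viaEmbedding_apply_of_notMem _ _ _ hy)
  rw [← map_pointHom_smul _ (face 0 e) _ _ hc q]
  congr 2

theorem exists_extension (j : Fin m ↪ Fin n) (e : Fin (p + 1) ↪ Fin n)
    (h : ∀ y, y ∈ Set.range j ↔ y ∉ Set.range e) :
    ∃ j' : Fin (m + 1) ↪ Fin n,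
    (∀ y, y ∈ Set.range j' ↔ y ∉ Set.range (face 0 e)) ∧
      (Equiv.Perm.viaEmbeddingHom j').comp (stabilization m) = Equiv.Perm.viaEmbeddingHom j := by
  have he : e 0 ∉ Set.range j := fun hi => (h _).1 hi ⟨0, rfl⟩
  -- The letter freed by the face is placed last, because `stabilization` fixes the last letter.
  let j' : Fin (m + 1) ↪ Fin n := ⟨Fin.snoc j (e 0), by
    rw [Fin.snoc_injective_iff]
    exact ⟨j.injective, he⟩⟩
  have hj₁ (i : Fin m) : j' i.castSucc = j i := Fin.snoc_castSucc (α := fun _ => Fin n) _ _ _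
  have hj₂ : j' (Fin.last m) = e 0 := Fin.snoc_last (α := fun _ => Fin n) _ _
  have hrange (y : Fin n) : y ∈ Set.range j' ↔ y ∈ Set.range j ∨ y = e 0 := by
    constructor
    · rintro ⟨i, rfl⟩
      refine Fin.lastCases ?_ (fun i => ?_) i
      · exact Or.inr hj₂
      · exact Or.inl ⟨i, (hj₁ i).symm⟩
    · rintro (⟨i, rfl⟩ | rfl)
      · exact ⟨_, hj₁ i⟩
      · exact ⟨_, hj₂⟩
  refine ⟨j', fun y => ?_, MonoidHom.ext fun σ => Equiv.ext fun y => ?_⟩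
  · rw [hrange, h]
    constructor
    · rintro (hy | rfl) ⟨i, hi⟩
      · exact hy ⟨_, hi⟩
      · exact Fin.succ_ne_zero i (e.injective hi)
    · intro hy
      by_contra hcon
      push Not at hcon
      obtain ⟨⟨i, rfl⟩, hne⟩ := hcon
      obtain ⟨l, rfl⟩ := Fin.exists_succ_eq.2 fun h0 => hne (congrArg e h0)
      exact hy ⟨l, rfl⟩
  · change Equiv.Perm.viaEmbedding (stabilization m σ) j' y = Equiv.Perm.viaEmbedding σ j y
    by_cases hy : y ∈ Set.range j
    · obtain ⟨i, rfl⟩ := hy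
      rw [Equiv.Perm.viaEmbedding_apply, ← hj₁, Equiv.Perm.viaEmbedding_apply,
        stabilization_castSucc, hj₁]
    · rw [Equiv.Perm.viaEmbedding_apply_of_notMem σ j y hy]
      by_cases hy0 : y = e 0
      · rw [hy0, ← hj₂, Equiv.Perm.viaEmbedding_apply, stabilization_last]
      · refine Equiv.Perm.viaEmbedding_apply_of_notMem _ _ _ fun hy' => ?_
        exact ((hrange y).1 hy').elim hy hy0

theorem map_pointHom_comp_coeffMap_boundaryHom (j : Fin m ↪ Fin n) (e : Fin (p + 1) ↪ Fin n)
    (h : ∀ y, y ∈ Set.range j ↔ y ∉ Set.range e) (q : ℕ) :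
    map (Equiv.Perm.viaEmbeddingHom j) (pointHom _ e (viaEmbeddingHom_smul_eq j e h)) q ≫
        coeffMap (boundaryHom n p) q =
      (if Even p then 1 else 0 : ℤ) • map (Equiv.Perm.viaEmbeddingHom j)
        (pointHom _ (face 0 e) fun σ => by
          rw [← face_smul, viaEmbeddingHom_smul_eq j e h]) q := by
  have h1 : coeffMap (boundaryHom n p) q =
      ∑ i : Fin (p + 1), (-1 : ℤ) ^ (i : ℕ) • coeffMap (faceHom n i) q := by
    change (functor ℤ (Equiv.Perm (Fin n)) q).map (boundaryHom n p) = _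
    rw [boundaryHom, Functor.map_sum]
    exact Finset.sum_congr rfl fun i _ => Functor.map_zsmul _
  rw [h1, Preadditive.comp_sum, ← sum_neg_one_pow_fin, Finset.sum_smul]
  refine Finset.sum_congr rfl fun i _ => ?_
  rw [Preadditive.comp_zsmul, map_pointHom_faceHom, map_pointHom_face_eq j e h i]

end stabilization

theorem exists_complementary (m p : ℕ) : ∃ (j : Fin m ↪ Fin (m + p)) (e : Fin p ↪ Fin (m + p)),
    ∀ y, y ∈ Set.range j ↔ y ∉ Set.range e := by
  refine ⟨Fin.castAddEmb p, Fin.natAddEmb m, fun y => ?_⟩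
  refine Fin.addCases (fun i => ?_) (fun i => ?_) y
  · simp [Fin.ext_iff]
    intro x hx
    omega
  · simp [Fin.ext_iff]
    intro x hx
    omega

theorem coeffMap_boundaryHom_eq_zero {n p : ℕ} (hp : Odd p) (hn : p + 1 ≤ n) (q : ℕ) :
    coeffMap (boundaryHom n p) q = 0 := by
  obtain ⟨m, rfl⟩ := Nat.exists_eq_add_of_le' hn
  obtain ⟨j, e, h⟩ := exists_complementary m (p + 1)
  have h1 := map_pointHom_comp_coeffMap_boundaryHom j e h q
  rw [if_neg (Nat.not_even_iff_odd.2 hp), zero_smul] at h1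
  have := isIso_map_pointHom j e h q
  rw [← cancel_epi (map _ (pointHom _ e (viaEmbeddingHom_smul_eq j e h)) q), h1, Limits.comp_zero]

theorem isIso_coeffMap_boundaryHom_iff {n m p : ℕ} (hp : Even p) (hn : n = m + (p + 1)) (q : ℕ) :
    IsIso (coeffMap (boundaryHom n p) q) ↔ IsIso (homologyStabilization m q) := by
  subst hn
  obtain ⟨j, e, h⟩ := exists_complementary m (p + 1)
  obtain ⟨j', h', hj'⟩ := exists_extension j e h
  have h1 := map_pointHom_comp_coeffMap_boundaryHom j e h q
  have h2 := stabilization_comp_map_pointHom (Equiv.Perm.viaEmbeddingHom j') (face 0 e)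
    (viaEmbeddingHom_smul_eq j' _ h') q
  rw [if_pos hp, one_smul] at h1
  refine isIso_iff_of_comp_eq_comp (isIso_map_pointHom j e h q) (isIso_map_pointHom j' _ h' q)
    (h1.trans (Eq.trans ?_ h2.symm))
  exact map_pointHom_congr hj'.symm _ _ q

end InjectiveWord

/-! ### Long exact sequences and the induction for stability -/

theorem CategoryTheory.shortExact_kernel_lift {C : Type*} [Category C] [Abelian C] {X Y Z : C}
    (f : X ⟶ Y) (g : Y ⟶ Z) (w : f ≫ g = 0) [Epi (Limits.kernel.lift g f w)] :
    (ShortComplex.mk (Limits.kernel.ι f) (Limits.kernel.lift g f w)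
      (by rw [← cancel_mono (Limits.kernel.ι g)]; simp)).ShortExact where
  exact := by
    let φ : ShortComplex.mk (Limits.kernel.ι f) (Limits.kernel.lift g f w)
        (by rw [← cancel_mono (Limits.kernel.ι g)]; simp) ⟶
          ShortComplex.mk (Limits.kernel.ι f) f (Limits.kernel.condition f) :=
      { τ₁ := 𝟙 _, τ₂ := 𝟙 _, τ₃ := Limits.kernel.ι g }
    have : Epi φ.τ₁ := inferInstanceAs (Epi (𝟙 _))
    have : IsIso φ.τ₂ := inferInstanceAs (IsIso (𝟙 _))
    have : Mono φ.τ₃ := inferInstanceAs (Mono (Limits.kernel.ι g))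
    exact (ShortComplex.exact_iff_of_epi_of_isIso_of_mono φ).2 (ShortComplex.exact_kernel f)
  mono_f := inferInstance
  epi_g := ‹_›

namespace groupHomology

variable {k G : Type u} [CommRing k] [Group G]

theorem epi_coeffMap_succ_of_mono {S : ShortComplex (Rep.{u} k G)} (hS : S.ShortExact) (q : ℕ)
    (h : Mono (coeffMap S.f q)) : Epi (coeffMap S.g (q + 1)) := by
  have hδ : δ hS (q + 1) q rfl = 0 := by
    rw [← cancel_mono (coeffMap S.f q), Limits.zero_comp]
    exact (mapShortComplex₁ hS (i := q + 1) (j := q) rfl).zero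
  exact (mapShortComplex₃_exact hS (i := q + 1) (j := q) rfl).epi_f hδ

theorem mono_coeffMap_of_eq_zero {S : ShortComplex (Rep.{u} k G)} (hS : S.ShortExact) (q : ℕ)
    (h : coeffMap S.f q = 0) : Mono (coeffMap S.g q) :=
  (mapShortComplex₂_exact hS q).mono_g h

theorem isIso_map_zero_of_trivial {H : Type u} [Group H] {V : Type u} [AddCommGroup V] [Module k V]
    (f : H →* G) (φ : Rep.trivial k H V ⟶ Rep.res f (Rep.trivial k G V))
    (hφ : ∀ v : V, φ.hom v = v) : IsIso (map f φ 0) := by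
  have h := H0π_comp_map f φ
  have h1 : φ.toModuleCatHom = 𝟙 (ModuleCat.of k V) := ModuleCat.hom_ext (LinearMap.ext hφ)
  have i1 : IsIso (H0π (Rep.trivial k H V)) := by
    rw [← H0IsoOfIsTrivial_inv_eq_π]; infer_instance
  have i2 : IsIso (H0π (Rep.trivial k G V)) := by
    rw [← H0IsoOfIsTrivial_inv_eq_π]; infer_instance
  refine (isIso_iff_of_comp_eq_comp i1 i2 h).2 ?_
  rw [h1]
  infer_instance

end groupHomology

namespace InjectiveWord

open Rep groupHomology SymmetricGroup Limits

theorem boundaryHom_comp_boundaryHom (n p : ℕ) : boundaryHom n (p + 1) ≫ boundaryHom n p = 0 :=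
  hom_ext_apply fun z => by
    refine (boundaryHom_apply n p _).trans ?_
    exact (congrArg _ (boundaryHom_apply n (p + 1) z)).trans (boundary_boundary n p z)

/-- The boundary operator, with values in the cycles. -/
def toCyclesHom (n p : ℕ) : wordRep n (p + 2) ⟶ kernel (boundaryHom n p) :=
  kernel.lift _ (boundaryHom n (p + 1)) (boundaryHom_comp_boundaryHom n p)

theorem epi_boundaryHom_zero {n : ℕ} (hn : 0 < n) : Epi (boundaryHom n 0) := by
  rw [Rep.epi_iff_surjective]
  intro z
  obtain ⟨y, hy⟩ := boundary_zero_surjective hn z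
  exact ⟨y, (boundaryHom_apply n 0 y).trans hy⟩

theorem epi_toCyclesHom {n p : ℕ} (hn : p + 1 < n) : Epi (toCyclesHom n p) := by
  have hex : (ShortComplex.mk _ _ (boundaryHom_comp_boundaryHom n p)).Exact := by
    refine exact_of_linear fun z hz => ?_
    obtain ⟨y, hy⟩ := exists_boundary_eq hn z ((boundaryHom_apply n p z).symm.trans hz)
    exact ⟨y, (boundaryHom_apply n (p + 1) y).trans hy⟩
  exact (ShortComplex.exact_iff_epi_kernel_lift _).1 hex

theorem coeffMap_toCyclesHom_comp_ι (n p q : ℕ) :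
    coeffMap (toCyclesHom n p) q ≫ coeffMap (kernel.ι (boundaryHom n p)) q =
      coeffMap (boundaryHom n (p + 1)) q := by
  rw [← map_id_comp, toCyclesHom, kernel.lift_ι]

theorem coeffMap_boundaryHom_comp_toCyclesHom (n p q : ℕ) :
    coeffMap (boundaryHom n (p + 2)) q ≫ coeffMap (toCyclesHom n p) q = 0 := by
  rw [← map_id_comp]
  have : boundaryHom n (p + 2) ≫ toCyclesHom n p = 0 := by
    rw [← cancel_mono (kernel.ι (boundaryHom n p)), Category.assoc, toCyclesHom, kernel.lift_ι,
      boundaryHom_comp_boundaryHom, zero_comp]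
  rw [this]
  exact (functor ℤ _ q).map_zero _ _

theorem epi_coeffMap_toCyclesHom_succ {n p q : ℕ} (hn : p + 1 < n)
    (h : Mono (coeffMap (kernel.ι (boundaryHom n (p + 1))) q)) :
    Epi (coeffMap (toCyclesHom n p) (q + 1)) := by
  have : Epi (kernel.lift _ (boundaryHom n (p + 1)) (boundaryHom_comp_boundaryHom n p)) :=
    epi_toCyclesHom hn
  exact epi_coeffMap_succ_of_mono
    (shortExact_kernel_lift _ _ (boundaryHom_comp_boundaryHom n p)) q h

/-- Stability in degree `q`, for all symmetric groups in the range. -/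
def StableInDegree (q : ℕ) : Prop :=
  ∀ m, 2 * q < m + 1 → IsIso (homologyStabilization m q)

theorem StableInDegree.isIso_coeffMap_boundaryHom {q : ℕ} (hq : StableInDegree q) {n p : ℕ}
    (hp : Even p) (hn : 2 * q + p < n) : IsIso (coeffMap (boundaryHom n p) q) :=
  (isIso_coeffMap_boundaryHom_iff (m := n - (p + 1)) hp (by omega) q).2 (hq _ (by omega))

/-- On `H_q` the map `W_{p+3} → W_{p+2}` is an isomorphism, yet its composite with `W_{p+2} → Z_p`
is zero. The latter is thus both zero and surjective. -/
theorem isZero_homology_kernel {n p q : ℕ} (hq : StableInDegree q) (hp : Even p)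
    (hn : 2 * q + p + 2 < n) (h : Epi (coeffMap (toCyclesHom n p) q)) :
    IsZero (groupHomology (kernel (boundaryHom n p)) q) := by
  have := hq.isIso_coeffMap_boundaryHom (n := n) (p := p + 2) (by simpa [Nat.even_add] using hp)
    (by omega)
  have h0 : coeffMap (toCyclesHom n p) q = 0 := by
    rw [← cancel_epi (coeffMap (boundaryHom n (p + 2)) q), coeffMap_boundaryHom_comp_toCyclesHom,
      comp_zero]
  exact IsZero.of_epi_eq_zero _ h0

/-- By the long exact sequence, surjectivity in degree `q + 1` follows from injectivity of
`H_q(Z_{p+1}) → H_q(W_{p+2})`. The extra unit of range for even `p` is what makes the final bound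
sharp enough. -/
theorem epi_coeffMap_toCyclesHom {n : ℕ} (q : ℕ) (hq : ∀ q' < q, StableInDegree q') (p : ℕ)
    (hp : p + 1 < n) (hn : 2 * q + p + 1 < n ∨ Even p ∧ 2 * q + p + 1 ≤ n) :
    Epi (coeffMap (toCyclesHom n p) q) := by
  induction q generalizing p with
  | zero =>
    have := epi_toCyclesHom hp
    exact epi_map_0_of_epi _
  | succ q ih =>
    have ih' := ih fun q' h => hq q' (by omega)
    refine epi_coeffMap_toCyclesHom_succ hp ?_
    by_cases hpe : Even p
    -- The isomorphism `H_q(W_{p+3}) → H_q(W_{p+2})` factors through `H_q(Z_{p+1})`; its first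
    -- factor is onto, so both factors are isomorphisms.
    · have h1 := ih' (p + 1) (by omega) (Or.inl (by omega))
      have h2 := (hq q (by omega)).isIso_coeffMap_boundaryHom (n := n) (p := p + 2)
        (by simpa [Nat.even_add] using hpe) (by omega)
      have h3 := coeffMap_toCyclesHom_comp_ι n (p + 1) q
      have h4 : Mono (coeffMap (toCyclesHom n (p + 1)) q) := mono_of_mono_fac h3
      have h5 : IsIso (coeffMap (toCyclesHom n (p + 1)) q) := isIso_of_mono_of_epi _
      rw [← (IsIso.inv_comp_eq _).2 h3.symm]
      infer_instance
    -- For odd `p` the source `H_q(Z_{p+1})` vanishes.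
    · have hn' := hn.resolve_right fun h => hpe h.1
      have hodd : Even (p + 1) := by simpa [Nat.even_add_one] using hpe
      exact (isZero_homology_kernel (hq q (by omega)) hodd (by omega)
        (ih' (p + 1) (by omega) (Or.inr ⟨hodd, by omega⟩))).mono _

theorem stableInDegree (r : ℕ) : StableInDegree r := by
  induction r using Nat.strong_induction_on with
  | _ r ih =>
    cases r with
    | zero => exact fun m _ => isIso_map_zero_of_trivial _ _ fun _ => rfl
    | succ q =>
      intro m hm
      rw [← isIso_coeffMap_boundaryHom_iff (n := m + 1) (p := 0) (by simp) (by omega)]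
      have := epi_boundaryHom_zero (n := m + 1) (by omega)
      have hS := shortExact_kernel (boundaryHom (m + 1) 0)
      -- Surjectivity: the obstruction lies in `H_q(Z_0) = 0`.
      have hepi : Epi (coeffMap (boundaryHom (m + 1) 0) (q + 1)) :=
        epi_coeffMap_succ_of_mono hS q <| (isZero_homology_kernel (ih q (by omega)) (by simp)
          (by omega) (epi_coeffMap_toCyclesHom q (fun q' h => ih q' (by omega)) 0 (by omega)
            (Or.inl (by omega)))).mono _
      -- Injectivity: `H_{q+1}(W_2)` surjects onto `H_{q+1}(Z_0)`, and its map on to `H_{q+1}(W_1)`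
      -- is a difference of two equal face maps, so `H_{q+1}(Z_0) → H_{q+1}(W_1)` is zero.
      have hmono : Mono (coeffMap (boundaryHom (m + 1) 0) (q + 1)) := by
        refine mono_coeffMap_of_eq_zero hS (q + 1) ?_
        have h1 := epi_coeffMap_toCyclesHom (n := m + 1) (q + 1) ih 0 (by omega)
          (Or.inr ⟨by simp, by omega⟩)
        have h2 := coeffMap_toCyclesHom_comp_ι (m + 1) 0 (q + 1)
        rw [coeffMap_boundaryHom_eq_zero (by simp) (by omega)] at h2
        exact (cancel_epi (coeffMap (toCyclesHom (m + 1) 0) (q + 1))).1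
          (h2.trans comp_zero.symm)
      exact isIso_of_mono_of_epi _

end InjectiveWord

end

theorem mainTheorem4 :
    (∀ m r : ℕ, 2 * r < m + 1 →
      CategoryTheory.IsIso (SymmetricGroup.homologyStabilization m r)) ∧
    (∀ m : ℕ, (orderedSubsetComplex (m + 1)).IsSpherical m) := by
  exact ⟨fun m r h => InjectiveWord.stableInDegree r m h, isSpherical_orderedSubsetComplex⟩
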